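/- Let $N\ge 1$, $\sigma\in(0,2)$, $\Lambda>0$, $\eta\ge 0$, and let $p\in[1,\frac{N}{(N-\sigma)_+})$, where the interval means $[1,\infty)$ if $N\le\sigma$. Then there are constants $C_{\eta,R}>0$ ($R>0$), depending only on $N,\sigma,\Lambda,p,\eta$ and $R$, and constants $C,c>0$, $R_0\ge1$, depending only on $N,\sigma,\Lambda,p$ and $\eta$, with $$C_{\eta,R}=C\,R^{-cR^{\sigma/2}}\quad\text{for all }R\ge R_0,$$ such that the following holds. Let $J$ be a measurable kernel on $\mathbb R^N\times\mathbb R^N$ with $J(x,y)=J(y,x)$ and $\frac{1}{\Lambda|x-y|^{N+\sigma}}\le J(x,y)\le\frac{\Lambda}{|x-y|^{N+\sigma}}$ for $x\ne y$, and $J(x,x+z)=J(x,x-z)$ for $z\neq0$, and put $$\mathcal Lf(x)=\mathrm{P.V.}\int_{\mathbb R^N}(f(x)-f(y))J(x,y)\,dy,\qquad \mathcal E(f,g)=\frac12\int_{\mathbb R^N}\int_{\mathbb R^N}(f(x)-f(y))(g(x)-g(y))J(x,y)\,dx\,dy .$$ Let $w$ be a bounded nonnegative weak supersolution of $\eta w+\mathcal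 Lw=0$ in $\mathbb R^N$, that is, $w\in L^\infty(\mathbb R^N)$, $w\ge0$ a.e., $$\int_{\mathbb R^N}\int_{\mathbb R^N}\frac{(w(x)-w(y))^2}{|x-y|^{N+\sigma}}\,dx\,dy<\infty,$$ and $\eta\int_{\mathbb R^N} w\phi\,dx+\mathcal E(w,\phi)\ge0$ for every nonnegative $\phi\in C_c^\infty(\mathbb R^N)$. Then, for every $x_0\in\mathbb R^N$ and $R>0$, $$\operatorname*{ess\,inf}_{B_R(x_0)}w\ \ge\ C_{\eta,R}\left(\int_{B_R(x_0)}w(x)^p\,dx\right)^{1/p}.$$ -/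

import Mathlib

open MeasureTheory Filter
open scoped ENNReal

noncomputable section

/-- The standing assumptions on the kernel `J` of a stable-like operator of order `σ` on `ℝ^N`,
with ellipticity constant `Λ`. Nothing is asked of `J` on the diagonal, which is a null set. -/
structure IsStableLikeKernel {N : ℕ} (σ Λ : ℝ)
    (J : EuclideanSpace ℝ (Fin N) → EuclideanSpace ℝ (Fin N) → ℝ) : Prop where
  aemeasurable : AEMeasurable
    (fun z : EuclideanSpace ℝ (Fin N) × EuclideanSpace ℝ (Fin N) => J z.1 z.2) volume
  symm : ∀ x y, x ≠ y → J x y = J y x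
  reflect : ∀ x z, z ≠ 0 → J x (x + z) = J x (x - z)
  lower : ∀ x y, x ≠ y → 1 / (Λ * ‖x - y‖ ^ ((N : ℝ) + σ)) ≤ J x y
  upper : ∀ x y, x ≠ y → J x y ≤ Λ / ‖x - y‖ ^ ((N : ℝ) + σ)

/-- The nonlocal interaction energy
`𝓔(f,g) = 1/2 ∬ (f(x) - f(y)) (g(x) - g(y)) J(x,y) dx dy`. -/
def energy {N : ℕ} (J : EuclideanSpace ℝ (Fin N) → EuclideanSpace ℝ (Fin N) → ℝ)
    (f g : EuclideanSpace ℝ (Fin N) → ℝ) : ℝ :=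
  (1 / 2) * ∫ z : EuclideanSpace ℝ (Fin N) × EuclideanSpace ℝ (Fin N),
    (f z.1 - f z.2) * (g z.1 - g z.2) * J z.1 z.2

/-- The square of the homogeneous fractional Sobolev (Gagliardo) seminorm of order `σ / 2`:
`∬ (w(x) - w(y))² / |x - y|^(N+σ) dx dy`, with values in `[0, ∞]`. -/
def gagliardoSq {N : ℕ} (σ : ℝ) (w : EuclideanSpace ℝ (Fin N) → ℝ) : ℝ≥0∞ :=
  ∫⁻ z : EuclideanSpace ℝ (Fin N) × EuclideanSpace ℝ (Fin N),
    ENNReal.ofReal ((w z.1 - w z.2) ^ 2 / ‖z.1 - z.2‖ ^ ((N : ℝ) + σ))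

/-- `w` is a weak supersolution of `η w + 𝓛 w = 0` in `ℝ^N`: it has finite energy, and
`η ∫ w φ + 𝓔(w, φ) ≥ 0` for every nonnegative test function `φ ∈ C_c^∞(ℝ^N)`. (If `J` is a
stable-like kernel of order `σ ∈ (0,2)`, all integrals here converge absolutely.) -/
structure IsWeakSupersolution {N : ℕ} (σ η : ℝ)
    (J : EuclideanSpace ℝ (Fin N) → EuclideanSpace ℝ (Fin N) → ℝ)
    (w : EuclideanSpace ℝ (Fin N) → ℝ) : Prop where
  locallyIntegrable : LocallyIntegrable w volume
  finite_energy : gagliardoSq σ w < ⊤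
  inequality : ∀ φ : EuclideanSpace ℝ (Fin N) → ℝ, ContDiff ℝ (⊤ : ℕ∞) φ →
    HasCompactSupport φ → (∀ x, 0 ≤ φ x) → 0 ≤ η * (∫ x, w x * φ x) + energy J w φ

end

noncomputable section

/-! Both halves of the estimate come from the nonlocality of the form; neither Moser iteration nor a
logarithmic estimate is needed. Let R ≥ 1 and let M be the integral of w over B_{2R}. Testing the
equation with a function that lives where w is below some level produces a nonnegative cross term:
the excess of w over the level at x, times its deficit at y, weighted by J(x,y). Everything else is
controlled by mass alone, because the reflection symmetry of J turns the energy of a nonnegative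
function against a squared cutoff ψ² into second differences of ψ² (`IsCutoff.integral_mul_sq_le`).

Lower half (`IsBoundedSupersolution.ae_le_of_mul_lt_integral`): test with v = (tψ² - w)₊. On B_{2R}
× B_{2R} the kernel is at least c R^{-(N+σ)}, so the cross term dominates c R^{-(N+σ)} ∫_{B_{2R}} (w
- tψ²)₊ · ∫ v, while the remaining terms are at most C t ∫ v. If t R^{N+σ} is small compared with M,
this forces v = 0. Hence w ≥ c R^{-(N+σ)} M on B_R.

Upper half: test with (k - w)₊ψ², which bounds the cross term by C k M
(`IsBoundedSupersolution.integral_level_le`). Keep only pairs in B_R at distance at most ρ, with ρ^N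
comparable to |{w > k/2}|. Each point of {w > 2k} then sees a fixed proportion of points where w ≤
k/2, and so |{w > 2k}| ≤ C (M/k) |{w > k/2}|^θ up to a power of R, for θ ≤ σ/N
(`IsBoundedSupersolution.level_recursion`). This recursion solves to a weak L^{1/(1-θ)} bound by M
(`le_rpow_of_level_recursion`), which controls the L^p norm for p < 1/(1-θ) (`eLpNorm_le_of_weak`).

Together the halves give the constant C R^{-2(N+σ)} for R ≥ 1 (`exists_weak_harnack`). It is
polynomial in R, hence better than the required C R^{-cR^{σ/2}}. Smaller radii follow by enlarging
the ball to radius one. The truncated test functions are admissible by mollification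
(`IsWeakSupersolution.inequality_of_gagliardoSq_lt_top`). -/

/-- The Euclidean space `ℝ^N`. -/
abbrev Euc (N : ℕ) := EuclideanSpace ℝ (Fin N)

/-! ### The stable measure and jump measures comparable to it. -/

section StableMeasure

variable {N : ℕ} {σ Λ : ℝ}

/-- The measure `|x - y|^{-(N+σ)} dx dy`. -/
def stableMeasure (N : ℕ) (σ : ℝ) : Measure (Euc N × Euc N) :=
  volume.withDensity fun z => ENNReal.ofReal (1 / ‖z.1 - z.2‖ ^ ((N : ℝ) + σ))

/-- The measure `J(x,y) dx dy`. -/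
def jumpMeasure (J : Euc N → Euc N → ℝ) : Measure (Euc N × Euc N) :=
  volume.withDensity fun z => ENNReal.ofReal (J z.1 z.2)

/-- The reflection of the second variable about the first. -/
def reflectSnd (z : Euc N × Euc N) : Euc N × Euc N := (z.1, z.1 - (z.2 - z.1))

/-- A jump measure comparable to the one of the `σ`-stable process and invariant under both
swapping the variables and reflecting the second one about the first. -/
structure IsJumpMeasure (σ Λ : ℝ) (ν : Measure (Euc N × Euc N)) : Prop where
  swap : MeasurePreserving Prod.swap ν ν
  reflect : MeasurePreserving reflectSnd ν ν
  le : ν ≤ ENNReal.ofReal Λ • stableMeasure N σ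
  ge : stableMeasure N σ ≤ ENNReal.ofReal Λ • ν

theorem nontrivial_euc (hN : 1 ≤ N) : Nontrivial (Euc N) := by
  have : Nonempty (Fin N) := ⟨⟨0, hN⟩⟩
  infer_instance

theorem ae_fst_ne_snd (hN : 1 ≤ N) : ∀ᵐ z : Euc N × Euc N, z.1 ≠ z.2 := by
  have := nontrivial_euc hN
  have h : MeasurableSet {z : Euc N × Euc N | z.1 ≠ z.2} :=
    (measurableSet_eq_fun measurable_fst measurable_snd).compl
  rw [Measure.volume_eq_prod, Measure.ae_prod_iff_ae_ae h]
  refine Eventually.of_forall fun x => ?_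
  have : ∀ᵐ y : Euc N, y ≠ x := by simp [ae_iff]
  filter_upwards [this] with y hy using hy.symm

theorem measurable_reflectSnd : Measurable (reflectSnd (N := N)) := by
  unfold reflectSnd; fun_prop

theorem reflectSnd_involutive : Function.Involutive (reflectSnd (N := N)) := by
  intro z; simp [reflectSnd]

theorem measurableEmbedding_reflectSnd : MeasurableEmbedding (reflectSnd (N := N)) :=
  (MeasurableEquiv.mk (reflectSnd_involutive.toPerm _) measurable_reflectSnd
    measurable_reflectSnd).measurableEmbedding

theorem measurePreserving_reflectSnd :
    MeasurePreserving (reflectSnd (N := N)) volume volume := by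
  refine (MeasurePreserving.id (volume : Measure (Euc N))).skew_product
    (g := fun x y : Euc N => x - (y - x)) (by fun_prop) (Eventually.of_forall fun x => ?_)
  have : (fun y : Euc N => x - (y - x)) = fun y => (x + x) - y := by ext y; simp; ring
  rw [this]
  exact (volume.measurePreserving_sub_left (x + x)).map_eq

theorem MeasureTheory.MeasurePreserving.withDensity_self {α : Type*} [MeasurableSpace α]
    {μ : Measure α} [SFinite μ] {e : α → α} (he : MeasurePreserving e μ μ)
    (hemb : MeasurableEmbedding e)
    {f : α → ℝ≥0∞} (hf : ∀ᵐ x ∂μ, f (e x) = f x) :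
    MeasurePreserving e (μ.withDensity f) (μ.withDensity f) := by
  refine ⟨he.measurable, ?_⟩
  ext s hs
  rw [Measure.map_apply he.measurable hs, withDensity_apply _ (he.measurable hs),
    withDensity_apply _ hs, ← he.setLIntegral_comp_preimage_emb hemb f s]
  exact lintegral_congr_ae (ae_restrict_of_ae (hf.mono fun x hx => hx.symm))

theorem jumpMeasure_isJumpMeasure (hN : 1 ≤ N) (hΛ : 0 < Λ) {J : Euc N → Euc N → ℝ}
    (hJ : IsStableLikeKernel σ Λ J) : IsJumpMeasure σ Λ (jumpMeasure J) where
  swap := by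
    refine MeasurePreserving.withDensity_self (Measure.measurePreserving_swap)
      MeasurableEquiv.prodComm.measurableEmbedding ?_
    filter_upwards [ae_fst_ne_snd hN] with z hz
    simp [hJ.symm z.2 z.1 hz.symm]
  reflect := by
    refine measurePreserving_reflectSnd.withDensity_self measurableEmbedding_reflectSnd ?_
    filter_upwards [ae_fst_ne_snd hN] with z hz
    have := hJ.reflect z.1 (z.2 - z.1) (sub_ne_zero.2 hz.symm)
    rw [add_sub_cancel] at this
    simp [reflectSnd, this]
  le := by
    rw [jumpMeasure, stableMeasure, ← withDensity_smul' _ _ ENNReal.ofReal_ne_top]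
    refine withDensity_mono ?_
    filter_upwards [ae_fst_ne_snd hN] with z hz
    simp only [Pi.smul_apply, smul_eq_mul]
    rw [← ENNReal.ofReal_mul hΛ.le, mul_one_div]
    exact ENNReal.ofReal_le_ofReal (hJ.upper _ _ hz)
  ge := by
    rw [jumpMeasure, stableMeasure, ← withDensity_smul' _ _ ENNReal.ofReal_ne_top]
    refine withDensity_mono ?_
    filter_upwards [ae_fst_ne_snd hN] with z hz
    simp only [Pi.smul_apply, smul_eq_mul]
    rw [← ENNReal.ofReal_mul hΛ.le]
    refine ENNReal.ofReal_le_ofReal ?_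
    have h := mul_le_mul_of_nonneg_left (hJ.lower _ _ hz) hΛ.le
    refine le_trans (le_of_eq ?_) h
    rw [mul_one_div, div_mul_eq_div_div, div_self hΛ.ne']

instance : SFinite (stableMeasure N σ) := by unfold stableMeasure; infer_instance

instance (J : Euc N → Euc N → ℝ) : SFinite (jumpMeasure J) := by unfold jumpMeasure; infer_instance

theorem measurable_stable_density :
    Measurable fun z : Euc N × Euc N => ENNReal.ofReal (1 / ‖z.1 - z.2‖ ^ ((N : ℝ) + σ)) := by
  fun_prop

theorem IsJumpMeasure.absolutelyContinuous {ν : Measure (Euc N × Euc N)}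
    (hν : IsJumpMeasure σ Λ ν) : ν ≪ volume :=
  ((Measure.absolutelyContinuous_of_le hν.le).trans Measure.smul_absolutelyContinuous).trans
    (withDensity_absolutelyContinuous _ _)

/-- Integral of a product of a function of the first variable and of the increment against the
stable measure. -/
theorem lintegral_stableMeasure_fst_mul {f H : Euc N → ℝ≥0∞} (hf : Measurable f)
    (hH : Measurable H) :
    ∫⁻ z, f z.1 * H (z.1 - z.2) ∂stableMeasure N σ =
      (∫⁻ x, f x) * ∫⁻ u : Euc N, H u * ENNReal.ofReal (1 / ‖u‖ ^ ((N : ℝ) + σ)) := by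
  rw [stableMeasure, lintegral_withDensity_eq_lintegral_mul _ measurable_stable_density
    (by fun_prop), Measure.volume_eq_prod, lintegral_prod _ (by fun_prop)]
  simp only [Pi.mul_apply]
  have : ∀ x : Euc N, ∫⁻ y : Euc N, ENNReal.ofReal (1 / ‖x - y‖ ^ ((N : ℝ) + σ)) *
      (f x * H (x - y)) =
      f x * ∫⁻ u : Euc N, H u * ENNReal.ofReal (1 / ‖u‖ ^ ((N : ℝ) + σ)) := by
    intro x
    rw [← lintegral_const_mul _ (by fun_prop),
      ← lintegral_sub_left_eq_self (fun u : Euc N =>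
        f x * (H u * ENNReal.ofReal (1 / ‖u‖ ^ ((N : ℝ) + σ)))) x]
    refine lintegral_congr fun y => ?_
    ring
  simp_rw [this]
  rw [lintegral_mul_const _ hf]

/-- The truncated second moment of the stable Lévy measure. -/
def levyMoment (N : ℕ) (σ : ℝ) : ℝ≥0∞ :=
  ∫⁻ u : Euc N, ENNReal.ofReal (min 1 (‖u‖ ^ 2)) * ENNReal.ofReal (1 / ‖u‖ ^ ((N : ℝ) + σ))

/-- In polar coordinates the integrand is r^{1-σ} on (0,1] and r^{-1-σ} beyond, so σ < 2 is what
integrability at the origin needs and σ > 0 what it needs at infinity. -/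
theorem levyMoment_lt_top (hN : 1 ≤ N) (h₀ : 0 < σ) (h₂ : σ < 2) : levyMoment N σ < ⊤ := by
  have := nontrivial_euc hN
  have key : Integrable (fun u : Euc N => min 1 (‖u‖ ^ 2) * (1 / ‖u‖ ^ ((N : ℝ) + σ))) := by
    rw [integrable_fun_norm_addHaar volume
      (f := fun r : ℝ => min 1 (r ^ 2) * (1 / r ^ ((N : ℝ) + σ)))]
    rw [finrank_euclideanSpace_fin, ← Set.Ioc_union_Ioi_eq_Ioi zero_le_one]
    have hpow : ∀ y : ℝ, 0 < y → y ^ (N - 1) * (1 / y ^ ((N : ℝ) + σ)) = y ^ (-1 - σ) := by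
      intro y hy
      rw [← Real.rpow_natCast, one_div, ← Real.rpow_neg hy.le, ← Real.rpow_add hy]
      congr 1
      push_cast [hN]
      ring
    refine IntegrableOn.union ?_ ?_
    · have h : IntegrableOn (fun y : ℝ => y ^ (1 - σ)) (Set.Ioc 0 1) := by
        rw [← intervalIntegrable_iff_integrableOn_Ioc_of_le zero_le_one]
        exact intervalIntegral.intervalIntegrable_rpow' (by linarith)
      refine h.congr_fun (fun y hy => ?_) measurableSet_Ioc
      have h1 : y ^ 2 ≤ 1 := by nlinarith [hy.1, hy.2]
      simp only [smul_eq_mul]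
      rw [min_eq_right h1, mul_left_comm, hpow y hy.1, ← Real.rpow_natCast, ← Real.rpow_add hy.1]
      congr 1
      push_cast
      ring
    · refine (integrableOn_Ioi_rpow_of_lt (a := -1 - σ) (by linarith) zero_lt_one).congr_fun
        (fun y hy => ?_) measurableSet_Ioi
      have hy' : 1 < y := hy
      have h1 : 1 ≤ y ^ 2 := by nlinarith
      simp only [smul_eq_mul]
      rw [min_eq_left h1, one_mul, hpow y (by linarith)]
  have h := key.lintegral_lt_top
  unfold levyMoment
  refine lt_of_le_of_lt (le_of_eq (lintegral_congr fun u => ?_)) h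
  rw [ENNReal.ofReal_mul (by positivity)]

/-- The density decreases with the distance, hence is bounded below on pairs at distance at most d.
This is how nonlocality enters: all such pairs interact, however they are placed. -/
theorem setLIntegral_le_stableMeasure {F : Euc N × Euc N → ℝ≥0∞} (hF : Measurable F)
    {s : Set (Euc N × Euc N)} (hs : MeasurableSet s) (hσ : 0 ≤ (N : ℝ) + σ)
    (hN : 1 ≤ N) {d : ℝ} (hd : ∀ z ∈ s, ‖z.1 - z.2‖ ≤ d) :
    ENNReal.ofReal (1 / d ^ ((N : ℝ) + σ)) * ∫⁻ z in s, F z ≤ ∫⁻ z in s, F z ∂stableMeasure N σ := by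
  rw [stableMeasure, setLIntegral_withDensity_eq_setLIntegral_mul _ measurable_stable_density hF hs,
    ← lintegral_const_mul _ hF]
  refine lintegral_mono_ae ?_
  rw [ae_restrict_iff' hs]
  filter_upwards [ae_fst_ne_snd hN] with z hz hzs
  simp only [Pi.mul_apply]
  gcongr
  · exact Real.rpow_pos_of_pos (norm_pos_iff.2 (sub_ne_zero.2 hz)) _
  · exact hd z hzs

end StableMeasure

/-! ### Enlarging the class of test functions by mollification. -/

section Density

variable {N : ℕ} {σ Λ : ℝ}

/-- Correlations of square-integrable functions are continuous. -/
theorem continuous_integral_mul_comp_sub {G : Type*} [NormedAddCommGroup G] [NormedSpace ℝ G]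
    [FiniteDimensional ℝ G]
    [MeasurableSpace G] [BorelSpace G] {μ : Measure G} [μ.IsAddHaarMeasure] {P Q : G → ℝ}
    (hP : MemLp P 2 μ) (hQ : MemLp Q 2 μ) : Continuous fun a : G => ∫ z, P z * Q (z - a) ∂μ := by
  -- The correlation is the L² inner product of P with a translate of Q, and translation acts
  -- continuously on L².
  let g : C(G, C(G, G)) := ContinuousMap.curry ⟨fun p : G × G => p.2 - p.1, by fun_prop⟩
  have hgm : ∀ a, MeasurePreserving (g a) μ μ := fun a => measurePreserving_sub_right μ a
  have h1 := (continuous_const (y := hQ.toLp Q)).compMeasurePreservingLp g.continuous hgm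
    ENNReal.ofNat_ne_top
  have h2 : Continuous fun a => inner ℝ (hP.toLp P)
      (Lp.compMeasurePreserving (g a) (hgm a) (hQ.toLp Q)) :=
    continuous_const.inner h1
  refine h2.congr fun a => ?_
  rw [L2.inner_def, Lp.toLp_compMeasurePreserving hQ (hgm a)]
  refine integral_congr_ae ?_
  filter_upwards [hP.coeFn_toLp, (hQ.comp_measurePreserving (hgm a)).coeFn_toLp] with z h h'
  rw [h, h']
  simp [g, mul_comm]

theorem memLp_div_of_gagliardoSq {f : Euc N → ℝ} (hf : Measurable f) (h : gagliardoSq σ f < ⊤) :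
    MemLp (fun z : Euc N × Euc N => (f z.1 - f z.2) / ‖z.1 - z.2‖ ^ (((N : ℝ) + σ) / 2)) 2
      volume := by
  have hm : Measurable
      (fun z : Euc N × Euc N => (f z.1 - f z.2) / ‖z.1 - z.2‖ ^ (((N : ℝ) + σ) / 2)) := by
    fun_prop
  rw [memLp_two_iff_integrable_sq hm.aestronglyMeasurable]
  refine ⟨(hm.pow_const 2).aestronglyMeasurable, ?_⟩
  rw [hasFiniteIntegral_iff_ofReal (Eventually.of_forall fun z => sq_nonneg _)]
  refine lt_of_le_of_lt (le_of_eq (lintegral_congr fun z => ?_)) h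
  rw [div_pow, ← Real.rpow_mul_natCast (norm_nonneg _)]
  norm_num

/-- The weight |x - y|^{(N+σ)/2} splits the energy into a pairing of two L² functions on the product
space. The kernel J, which is not translation invariant, stays entirely with the factor that is
never translated. -/
theorem memLp_mul_kernel (hN : 1 ≤ N) (hΛ : 0 < Λ) {J : Euc N → Euc N → ℝ}
    (hJ : IsStableLikeKernel σ Λ J) {f : Euc N → ℝ} (hf : Measurable f)
    (h : gagliardoSq σ f < ⊤) :
    MemLp (fun z : Euc N × Euc N =>
      (f z.1 - f z.2) * J z.1 z.2 * ‖z.1 - z.2‖ ^ (((N : ℝ) + σ) / 2)) 2 volume := by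
  refine (memLp_div_of_gagliardoSq hf h).of_le_mul (c := Λ) ?_ ?_
  · have := hJ.aemeasurable.aestronglyMeasurable
    have h1 : Measurable fun z : Euc N × Euc N => f z.1 - f z.2 := by fun_prop
    have h2 : Measurable fun z : Euc N × Euc N => ‖z.1 - z.2‖ ^ (((N : ℝ) + σ) / 2) := by fun_prop
    exact (h1.aestronglyMeasurable.mul this).mul h2.aestronglyMeasurable
  · filter_upwards [ae_fst_ne_snd hN] with z hz
    have hpos : 0 < ‖z.1 - z.2‖ := norm_pos_iff.2 (sub_ne_zero.2 hz)
    have hr := Real.rpow_pos_of_pos hpos (((N : ℝ) + σ) / 2)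
    have hsq : ‖z.1 - z.2‖ ^ ((N : ℝ) + σ) =
        ‖z.1 - z.2‖ ^ (((N : ℝ) + σ) / 2) * ‖z.1 - z.2‖ ^ (((N : ℝ) + σ) / 2) := by
      rw [← Real.rpow_add hpos]; congr 1; ring
    have hJ0 : 0 ≤ J z.1 z.2 := le_trans (by positivity) (hJ.lower _ _ hz)
    have hJ1 := hJ.upper _ _ hz
    rw [hsq, le_div_iff₀ (by positivity)] at hJ1
    rw [norm_mul, norm_mul, norm_div, Real.norm_of_nonneg hJ0, Real.norm_of_nonneg hr.le,
      mul_div_assoc', le_div_iff₀ hr]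
    calc ‖f z.1 - f z.2‖ * J z.1 z.2 * ‖z.1 - z.2‖ ^ (((N : ℝ) + σ) / 2) *
          ‖z.1 - z.2‖ ^ (((N : ℝ) + σ) / 2)
        = ‖f z.1 - f z.2‖ * (J z.1 z.2 * (‖z.1 - z.2‖ ^ (((N : ℝ) + σ) / 2) *
          ‖z.1 - z.2‖ ^ (((N : ℝ) + σ) / 2))) := by ring
      _ ≤ ‖f z.1 - f z.2‖ * Λ := by gcongr
      _ = _ := mul_comm _ _

/-- Diagonal translation of a pair of points. -/
theorem measurePreserving_diag_sub :
    MeasurePreserving (fun q : Euc N × (Euc N × Euc N) => (q.1, q.2 - (q.1, q.1)))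
      (volume.prod (volume.prod volume)) (volume.prod (volume.prod volume)) := by
  refine (MeasurePreserving.id (volume : Measure (Euc N))).skew_product
    (g := fun (s : Euc N) (z : Euc N × Euc N) => z - (s, s)) (by fun_prop)
    (Eventually.of_forall fun s => ?_)
  exact (measurePreserving_sub_right ((volume : Measure (Euc N)).prod volume) (s, s)).map_eq

section Mollify

variable {J : Euc N → Euc N → ℝ} {w v ρ : Euc N → ℝ} {W V : ℝ}

theorem integrable_of_bounded_compactSupport (hv : Measurable v) (hvb : ∀ x, |v x| ≤ V)
    (hvc : HasCompactSupport v) : Integrable v := by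
  have : IntegrableOn v (tsupport v) :=
    Measure.integrableOn_of_bounded (M := V) hvc.isCompact.measure_lt_top.ne
      hv.aestronglyMeasurable (Eventually.of_forall hvb)
  exact (integrableOn_iff_integrable_of_support_subset (subset_tsupport v)).1 this

theorem memLp_two_of_bounded_compactSupport (hv : Measurable v) (hvb : ∀ x, |v x| ≤ V)
    (hvc : HasCompactSupport v) : MemLp v 2 volume := by
  rw [memLp_two_iff_integrable_sq hv.aestronglyMeasurable]
  refine integrable_of_bounded_compactSupport (V := V ^ 2) (hv.pow_const 2) (fun x => ?_)
    (hvc.comp_left (g := fun t => t ^ 2) (by simp))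
  rw [abs_pow]
  exact pow_le_pow_left₀ (abs_nonneg _) (hvb x) 2

/-- Testing against a mollification is averaging the tests against translates. -/
theorem integral_mul_mollify (hw : Measurable w) (hwb : ∀ x, |w x| ≤ W) (hv : Integrable v)
    (hρ : Integrable ρ) :
    Integrable (fun s => ρ s * ∫ x, w x * v (x - s)) ∧
    ∫ x, w x * ∫ s, ρ s * v (x - s) = ∫ s, ρ s * ∫ x, w x * v (x - s) := by
  have h1 : Integrable (fun p : Euc N × Euc N => w p.1 * (ρ p.2 * v (p.1 - p.2)))
      (volume.prod volume) := by
    refine Integrable.bdd_mul (c := W) ?_ (hw.comp measurable_fst).aestronglyMeasurable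
      (Eventually.of_forall fun p => hwb p.1)
    exact hρ.convolution_integrand (ContinuousLinearMap.mul ℝ ℝ) hv
  have h2 := h1.integral_prod_right
  have h3 := integral_integral_swap
    (f := fun x s => w x * (ρ s * v (x - s))) (μ := volume) (ν := volume) h1
  have e : ∀ s, ∫ x, w x * (ρ s * v (x - s)) = ρ s * ∫ x, w x * v (x - s) := by
    intro s
    rw [← integral_const_mul]
    exact integral_congr_ae (Eventually.of_forall fun x => by simp only; ring)
  simp only [e] at h2 h3
  refine ⟨h2, ?_⟩
  rw [← h3]
  simp_rw [integral_const_mul]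

theorem energy_mollify (hN : 1 ≤ N) (hΛ : 0 < Λ) (hJ : IsStableLikeKernel σ Λ J)
    (hw : Measurable w) (hwe : gagliardoSq σ w < ⊤) (hv : Measurable v) (hvb : ∀ x, |v x| ≤ V)
    (hve : gagliardoSq σ v < ⊤) (hρ : Integrable ρ) (hρ0 : ∀ x, 0 ≤ ρ x) (hρm : Measurable ρ) :
    Integrable (fun s => ρ s * energy J w (fun x => v (x - s))) ∧
    energy J w (fun x => ∫ s, ρ s * v (x - s)) =
      ∫ s, ρ s * energy J w (fun x => v (x - s)) := by
  set P := fun z : Euc N × Euc N =>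
    (w z.1 - w z.2) * J z.1 z.2 * ‖z.1 - z.2‖ ^ (((N : ℝ) + σ) / 2) with hPdef
  set Q := fun z : Euc N × Euc N => (v z.1 - v z.2) / ‖z.1 - z.2‖ ^ (((N : ℝ) + σ) / 2) with hQdef
  have hP : MemLp P 2 volume := memLp_mul_kernel hN hΛ hJ hw hwe
  have hQ : MemLp Q 2 volume := memLp_div_of_gagliardoSq hv hve
  have hQm : Measurable Q := by rw [hQdef]; fun_prop
  have hint : Integrable (fun q : Euc N × (Euc N × Euc N) => ρ q.1 * (P q.2 * Q (q.2 - (q.1, q.1))))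
      (volume.prod (volume.prod volume)) := by
    -- Fubini is justified by |PQ| ≤ P² + Q²: translating v by s moves Q along the diagonal by (s,
    -- s), which preserves the measure, so both squares are integrable against ρ.
    have i1 : Integrable (fun q : Euc N × (Euc N × Euc N) => ρ q.1 * (P q.2) ^ 2)
        (volume.prod (volume.prod volume)) := hρ.mul_prod hP.integrable_sq
    have i2 : Integrable (fun q : Euc N × (Euc N × Euc N) => ρ q.1 * (Q (q.2 - (q.1, q.1))) ^ 2)
        (volume.prod (volume.prod volume)) :=
      measurePreserving_diag_sub.integrable_comp_of_integrable
        (g := fun q : Euc N × (Euc N × Euc N) => ρ q.1 * (Q q.2) ^ 2)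
        (hρ.mul_prod hQ.integrable_sq)
    refine (i1.add i2).mono' ?_ (Eventually.of_forall fun q => ?_)
    · have a1 : AEStronglyMeasurable (fun q : Euc N × (Euc N × Euc N) => P q.2)
          (volume.prod (volume.prod volume)) := hP.aestronglyMeasurable.comp_snd
      have a2 : Measurable (fun q : Euc N × (Euc N × Euc N) => ρ q.1) := by fun_prop
      have a3 : Measurable (fun q : Euc N × (Euc N × Euc N) => Q (q.2 - (q.1, q.1))) := by fun_prop
      exact a2.aestronglyMeasurable.mul (a1.mul a3.aestronglyMeasurable)
    · simp only [Pi.add_apply]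
      rw [norm_mul, Real.norm_of_nonneg (hρ0 _), ← mul_add]
      refine mul_le_mul_of_nonneg_left ?_ (hρ0 _)
      rw [Real.norm_eq_abs, abs_le]
      constructor <;> nlinarith [sq_nonneg (P q.2 - Q (q.2 - (q.1, q.1))),
        sq_nonneg (P q.2 + Q (q.2 - (q.1, q.1))), sq_nonneg (P q.2),
        sq_nonneg (Q (q.2 - (q.1, q.1)))]
  have hPQ : ∀ᵐ z : Euc N × Euc N, ∀ a b : ℝ,
      (w z.1 - w z.2) * (a - b) * J z.1 z.2 =
        P z * ((a - b) / ‖z.1 - z.2‖ ^ (((N : ℝ) + σ) / 2)) := by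
    filter_upwards [ae_fst_ne_snd hN] with z hz a b
    have hr := Real.rpow_pos_of_pos (norm_pos_iff.2 (sub_ne_zero.2 hz)) (((N : ℝ) + σ) / 2)
    rw [hPdef]
    field_simp
  have hE : ∀ s, energy J w (fun x => v (x - s)) = (1 / 2) * ∫ z, P z * Q (z - (s, s)) := by
    intro s
    unfold energy
    congr 1
    refine integral_congr_ae ?_
    filter_upwards [hPQ] with z hz
    rw [hz, hQdef]
    simp
  have hvs : ∀ x, Integrable fun s => ρ s * v (x - s) := by
    intro x
    refine hρ.mul_bdd (c := V) ?_ (Eventually.of_forall fun s => hvb _)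
    exact Measurable.aestronglyMeasurable (by fun_prop)
  have hE' : energy J w (fun x => ∫ s, ρ s * v (x - s)) =
      (1 / 2) * ∫ z, P z * ∫ s, ρ s * Q (z - (s, s)) := by
    unfold energy
    congr 1
    refine integral_congr_ae ?_
    filter_upwards [hPQ] with z hz
    rw [hz, ← integral_sub (hvs _) (hvs _), ← integral_div]
    congr 1
    refine integral_congr_ae (Eventually.of_forall fun s => ?_)
    simp only [hQdef, Prod.fst_sub, Prod.snd_sub, sub_sub_sub_cancel_right]
    ring
  have h2 := hint.integral_prod_left
  have h3 := integral_integral_swap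
    (f := fun s z => ρ s * (P z * Q (z - (s, s)))) hint
  simp only [integral_const_mul] at h2 h3
  simp only [hE, hE', mul_left_comm (_ : ℝ) (1 / 2 : ℝ)]
  refine ⟨h2.const_mul _, ?_⟩
  rw [integral_const_mul]
  congr 1
  refine Eq.trans ?_ h3.symm
  refine integral_congr_ae (Eventually.of_forall fun z => ?_)
  simp only
  rw [← integral_const_mul]
  exact integral_congr_ae (Eventually.of_forall fun s => by simp only; ring)

theorem continuous_energy_translate (hN : 1 ≤ N) (hΛ : 0 < Λ) (hJ : IsStableLikeKernel σ Λ J)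
    (hw : Measurable w) (hwe : gagliardoSq σ w < ⊤) (hv : Measurable v)
    (hve : gagliardoSq σ v < ⊤) :
    Continuous fun s => energy J w (fun x => v (x - s)) := by
  have h := (continuous_integral_mul_comp_sub (μ := (volume : Measure (Euc N)).prod volume)
    (memLp_mul_kernel hN hΛ hJ hw hwe) (memLp_div_of_gagliardoSq hv hve)).comp
    (f := fun s : Euc N => (s, s)) (by fun_prop)
  refine (h.const_mul (1 / 2)).congr fun s => ?_
  unfold energy
  congr 1
  refine integral_congr_ae ?_
  filter_upwards [ae_fst_ne_snd hN] with z hz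
  have hr := Real.rpow_pos_of_pos (norm_pos_iff.2 (sub_ne_zero.2 hz)) (((N : ℝ) + σ) / 2)
  simp only [Prod.fst_sub, Prod.snd_sub, sub_sub_sub_cancel_right]
  field_simp

/-- A bounded w need not be in L², but for |s| < 1 the translates of v are supported in one fixed
ball, and w may be cut off there. -/
theorem continuousAt_integral_translate (hw : Measurable w) (hwb : ∀ x, |w x| ≤ W)
    (hv : Measurable v) (hvb : ∀ x, |v x| ≤ V) (hvc : HasCompactSupport v) :
    ContinuousAt (fun s => ∫ x, w x * v (x - s)) 0 := by
  obtain ⟨r, hr⟩ := hvc.isCompact.isBounded.subset_ball (0 : Euc N)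
  have hP : MemLp ((Metric.ball (0 : Euc N) (r + 1)).indicator w) 2 volume := by
    have : HasCompactSupport ((Metric.ball (0 : Euc N) (r + 1)).indicator w) :=
      HasCompactSupport.of_support_subset_isCompact (isCompact_closedBall (0 : Euc N) (r + 1))
        (Set.support_indicator_subset.trans Metric.ball_subset_closedBall)
    refine memLp_two_of_bounded_compactSupport (V := W) (hw.indicator measurableSet_ball)
      (fun x => ?_) this
    by_cases hx : x ∈ Metric.ball (0 : Euc N) (r + 1)
    · rw [Set.indicator_of_mem hx]; exact hwb x
    · rw [Set.indicator_of_notMem hx]; exact le_trans (by simp) ((abs_nonneg _).trans (hwb x))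
  refine (continuous_integral_mul_comp_sub hP
    (memLp_two_of_bounded_compactSupport hv hvb hvc)).continuousAt.congr ?_
  filter_upwards [Metric.ball_mem_nhds (0 : Euc N) one_pos] with s hs
  refine integral_congr_ae (Eventually.of_forall fun x => ?_)
  simp only
  by_cases hx : x ∈ Metric.ball (0 : Euc N) (r + 1)
  · rw [Set.indicator_of_mem hx]
  · have : v (x - s) = 0 := by
      by_contra h
      have h1 := hr (subset_tsupport v h)
      rw [mem_ball_zero_iff] at h1 hs hx
      have h2 := norm_add_le (x - s) s
      rw [sub_add_cancel] at h2
      linarith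
    rw [this]; simp

/-- The inequality defining weak supersolutions extends from smooth test functions to bounded
compactly supported ones of finite energy. -/
theorem IsWeakSupersolution.inequality_of_gagliardoSq_lt_top (hN : 1 ≤ N)
    (hΛ : 0 < Λ) {η : ℝ} (hJ : IsStableLikeKernel σ Λ J)
    (hsup : IsWeakSupersolution σ η J w) (hw : Measurable w) (hwb : ∀ x, |w x| ≤ W)
    (hv : Measurable v) (hv0 : ∀ x, 0 ≤ v x) (hvb : ∀ x, v x ≤ V) (hvc : HasCompactSupport v)
    (hve : gagliardoSq σ v < ⊤) : 0 ≤ η * (∫ x, w x * v x) + energy J w v := by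
  have hvb' : ∀ x, |v x| ≤ V := fun x => by rw [abs_of_nonneg (hv0 x)]; exact hvb x
  have hvi := integrable_of_bounded_compactSupport hv hvb' hvc
  set l : Euc N → ℝ := fun s =>
    η * (∫ x, w x * v (x - s)) + energy J w (fun x => v (x - s)) with hl
  have hl0 : l 0 = η * (∫ x, w x * v x) + energy J w v := by simp [hl]
  -- A smooth mollification of v is admissible, and testing with it gives the ρ-average of l. If
  -- l(0) were negative, ρ could be concentrated where l < l(0)/2, and the average would be
  -- negative.
  have hcont : ContinuousAt l 0 :=
    (continuousAt_const.mul (continuousAt_integral_translate hw hwb hv hvb' hvc)).add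
      (continuous_energy_translate hN hΛ hJ hw hsup.finite_energy hv hve).continuousAt
  rw [← hl0]
  by_contra! hneg
  have hev : ∀ᶠ s in nhds 0, l s < l 0 / 2 := hcont.eventually_lt_const (by linarith)
  obtain ⟨δ, hδ, hball⟩ := Metric.eventually_nhds_iff_ball.1 hev
  let b : ContDiffBump (0 : Euc N) := ⟨δ / 2, δ, by positivity, by linarith⟩
  set ρ := b.normed volume with hρ
  have hρc : ContDiff ℝ (⊤ : ℕ∞) ρ := b.contDiff_normed
  have hρs : HasCompactSupport ρ := b.hasCompactSupport_normed
  have hρ0 : ∀ x, 0 ≤ ρ x := fun x => b.nonneg_normed x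
  have hρi : Integrable ρ := hρc.continuous.integrable_of_hasCompactSupport hρs
  obtain ⟨i1, e1⟩ := integral_mul_mollify hw hwb hvi hρi
  obtain ⟨i2, e2⟩ := energy_mollify hN hΛ hJ hw hsup.finite_energy hv hvb' hve hρi hρ0
    hρc.continuous.measurable
  have htest := hsup.inequality (fun x => ∫ s, ρ s * v (x - s))
    (hρs.contDiff_convolution_left (ContinuousLinearMap.mul ℝ ℝ) hρc hvi.locallyIntegrable)
    (hρs.convolution (ContinuousLinearMap.mul ℝ ℝ) hvc)
    (fun x => integral_nonneg fun s => mul_nonneg (hρ0 _) (hv0 _))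
  rw [e1, e2, ← integral_const_mul, ← integral_add (i1.const_mul _) i2] at htest
  have hle : ∫ s, (η * (ρ s * ∫ x, w x * v (x - s)) + ρ s * energy J w fun x => v (x - s)) ≤
      ∫ s, ρ s * (l 0 / 2) := by
    refine integral_mono ((i1.const_mul _).add i2) (hρi.mul_const _) fun s => ?_
    have : η * (ρ s * ∫ x, w x * v (x - s)) + ρ s * energy J w (fun x => v (x - s)) =
        ρ s * l s := by simp only [hl]; ring
    simp only [this]
    by_cases hs : s ∈ Metric.ball (0 : Euc N) δ
    · exact mul_le_mul_of_nonneg_left (hball s hs).le (hρ0 s)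
    · have : ρ s = 0 := by
        have : s ∉ Function.support ρ := by rw [hρ, b.support_normed_eq]; exact hs
        simpa using this
      simp [this]
  rw [integral_mul_const, b.integral_normed] at hle
  linarith

end Mollify

end Density

/-! ### Cutoff functions and their energy against nonnegative functions. -/

section Cutoff

variable {N : ℕ} {σ Λ : ℝ}

/-- A cutoff function between two concentric balls of radii `R` and `2R`, with a bound `A` for its
differences and for the second differences of its square. -/
structure IsCutoff (A : ℝ) (x₀ : Euc N) (R : ℝ) (ψ : Euc N → ℝ) : Prop where
  measurable : Measurable ψ
  const_nonneg : 0 ≤ A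
  nonneg : ∀ x, 0 ≤ ψ x
  le_one : ∀ x, ψ x ≤ 1
  eq_one : ∀ x ∈ Metric.ball x₀ R, ψ x = 1
  eq_zero : ∀ x ∉ Metric.ball x₀ (2 * R), ψ x = 0
  sq_sub_le : ∀ x y, (ψ x - ψ y) ^ 2 ≤ A * min 1 (‖x - y‖ ^ 2)
  second_le : ∀ x z, 2 * ψ x ^ 2 - ψ (x + z) ^ 2 - ψ (x - z) ^ 2 ≤ A * min 1 (‖z‖ ^ 2)

/-- A bounded nonnegative weak supersolution, with the test functions and the integrability
expressed through the jump measure `ν`. -/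
structure IsBoundedSupersolution (ν : Measure (Euc N × Euc N)) (η W : ℝ) (w : Euc N → ℝ) :
    Prop where
  measurable : Measurable w
  nonneg : ∀ x, 0 ≤ w x
  le : ∀ x, w x ≤ W
  memLp : MemLp (fun z : Euc N × Euc N => w z.1 - w z.2) 2 ν
  test : ∀ v : Euc N → ℝ, Measurable v → (∀ x, 0 ≤ v x) → (∃ V, ∀ x, v x ≤ V) →
    HasCompactSupport v → MemLp (fun z : Euc N × Euc N => v z.1 - v z.2) 2 ν →
    0 ≤ η * (∫ x, w x * v x) + (1 / 2) * ∫ z, (w z.1 - w z.2) * (v z.1 - v z.2) ∂ν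

variable {ν : Measure (Euc N × Euc N)} {A R η W : ℝ} {x₀ : Euc N} {f g h w ψ : Euc N → ℝ}

theorem memLp_sub_of_le {a b : ℝ} (hf : Measurable f)
    (hg : MemLp (fun z : Euc N × Euc N => g z.1 - g z.2) 2 ν)
    (hh : MemLp (fun z : Euc N × Euc N => h z.1 - h z.2) 2 ν)
    (hle : ∀ x y, |f x - f y| ≤ a * |g x - g y| + b * |h x - h y|) :
    MemLp (fun z : Euc N × Euc N => f z.1 - f z.2) 2 ν := by
  have hfm : Measurable (fun z : Euc N × Euc N => f z.1 - f z.2) := by fun_prop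
  refine ((hg.norm.const_mul a).add (hh.norm.const_mul b)).of_le hfm.aestronglyMeasurable
    (Eventually.of_forall fun z => ?_)
  exact (hle z.1 z.2).trans (le_abs_self _)

theorem IsJumpMeasure.lintegral_le (hν : IsJumpMeasure σ Λ ν) (F : Euc N × Euc N → ℝ≥0∞) :
    ∫⁻ z, F z ∂ν ≤ ENNReal.ofReal Λ * ∫⁻ z, F z ∂stableMeasure N σ := by
  rw [← smul_eq_mul, ← lintegral_smul_measure]
  exact lintegral_mono' hν.le le_rfl

theorem IsJumpMeasure.lintegral_ge (hν : IsJumpMeasure σ Λ ν) (F : Euc N × Euc N → ℝ≥0∞) :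
    ∫⁻ z, F z ∂stableMeasure N σ ≤ ENNReal.ofReal Λ * ∫⁻ z, F z ∂ν := by
  rw [← smul_eq_mul, ← lintegral_smul_measure]
  exact lintegral_mono' hν.ge le_rfl

theorem IsJumpMeasure.integrable_fst_mul_min (hν : IsJumpMeasure σ Λ ν) (hΛ : 0 < Λ) (hN : 1 ≤ N)
    (h₀ : 0 < σ) (h₂ : σ < 2) (hf : Measurable f) (hf0 : ∀ x, 0 ≤ f x) (hfi : Integrable f) :
    Integrable (fun z : Euc N × Euc N => f z.1 * min 1 (‖z.1 - z.2‖ ^ 2)) ν ∧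
    ∫ z, f z.1 * min 1 (‖z.1 - z.2‖ ^ 2) ∂ν ≤ Λ * (levyMoment N σ).toReal * ∫ x, f x := by
  have hm : Measurable (fun z : Euc N × Euc N => f z.1 * min 1 (‖z.1 - z.2‖ ^ 2)) := by fun_prop
  have h0 : ∀ z : Euc N × Euc N, 0 ≤ f z.1 * min 1 (‖z.1 - z.2‖ ^ 2) := fun z =>
    mul_nonneg (hf0 _) (by positivity)
  have hle : ∫⁻ z, ENNReal.ofReal (f z.1 * min 1 (‖z.1 - z.2‖ ^ 2)) ∂ν ≤
      ENNReal.ofReal (Λ * (levyMoment N σ).toReal * ∫ x, f x) := by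
    refine (hν.lintegral_le _).trans (le_of_eq ?_)
    simp_rw [ENNReal.ofReal_mul (hf0 _)]
    rw [lintegral_stableMeasure_fst_mul (f := fun x => ENNReal.ofReal (f x))
      (H := fun u => ENNReal.ofReal (min 1 (‖u‖ ^ 2))) (by fun_prop) (by fun_prop)]
    rw [← ofReal_integral_eq_lintegral_ofReal hfi (Eventually.of_forall hf0),
      ENNReal.ofReal_mul (by positivity), ENNReal.ofReal_mul hΛ.le,
      ENNReal.ofReal_toReal (levyMoment_lt_top hN h₀ h₂).ne, levyMoment]
    ring
  have hi : Integrable (fun z : Euc N × Euc N => f z.1 * min 1 (‖z.1 - z.2‖ ^ 2)) ν := by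
    refine ⟨hm.aestronglyMeasurable, ?_⟩
    rw [hasFiniteIntegral_iff_ofReal (Eventually.of_forall h0)]
    exact hle.trans_lt ENNReal.ofReal_lt_top
  refine ⟨hi, ?_⟩
  rw [← ofReal_integral_eq_lintegral_ofReal hi (Eventually.of_forall h0)] at hle
  exact (ENNReal.ofReal_le_ofReal_iff
    (mul_nonneg (by positivity) (integral_nonneg hf0))).1 hle

/-- Lower bound of an integral against the jump measure by a Lebesgue integral over pairs at
distance at most `d`. -/
theorem IsJumpMeasure.setLIntegral_le (hν : IsJumpMeasure σ Λ ν) (hΛ : 0 < Λ) (hN : 1 ≤ N)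
    (h₀ : 0 < σ) {F : Euc N × Euc N → ℝ} (hF : Measurable F) (hF0 : ∀ z, 0 ≤ F z)
    (hFi : Integrable F ν) {s : Set (Euc N × Euc N)} (hs : MeasurableSet s) {d : ℝ}
    (hd : ∀ z ∈ s, ‖z.1 - z.2‖ ≤ d) :
    ENNReal.ofReal (1 / d ^ ((N : ℝ) + σ)) * ∫⁻ z in s, ENNReal.ofReal (F z) ≤
      ENNReal.ofReal (Λ * ∫ z, F z ∂ν) := by
  refine (setLIntegral_le_stableMeasure (by fun_prop) hs (by positivity) hN hd).trans ?_
  refine (setLIntegral_le_lintegral _ _).trans ((hν.lintegral_ge _).trans ?_)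
  rw [ENNReal.ofReal_mul hΛ.le,
    ofReal_integral_eq_lintegral_ofReal hFi (Eventually.of_forall hF0)]

theorem integrable_indicator_ball {F r : ℝ} (hf : Measurable f) (hf0 : ∀ x, 0 ≤ f x)
    (hfb : ∀ x, f x ≤ F) : Integrable ((Metric.ball x₀ r).indicator f) := by
  rw [integrable_indicator_iff measurableSet_ball]
  exact Measure.integrableOn_of_bounded (M := F) measure_ball_lt_top.ne hf.aestronglyMeasurable
    (Eventually.of_forall fun x => by rw [Real.norm_of_nonneg (hf0 x)]; exact hfb x)

/-- Integrals of the second moment of the jumps starting in a ball. -/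
theorem IsJumpMeasure.integrable_indicator_mul_min (hν : IsJumpMeasure σ Λ ν) (hΛ : 0 < Λ)
    (hN : 1 ≤ N) (h₀ : 0 < σ) (h₂ : σ < 2) {F r : ℝ} (hf : Measurable f) (hf0 : ∀ x, 0 ≤ f x)
    (hfb : ∀ x, f x ≤ F) :
    Integrable (fun z : Euc N × Euc N =>
      (Metric.ball x₀ r).indicator f z.1 * min 1 (‖z.1 - z.2‖ ^ 2)) ν ∧
    ∫ z, (Metric.ball x₀ r).indicator f z.1 * min 1 (‖z.1 - z.2‖ ^ 2) ∂ν ≤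
      Λ * (levyMoment N σ).toReal * ∫ x in Metric.ball x₀ r, f x := by
  rw [← integral_indicator measurableSet_ball]
  exact hν.integrable_fst_mul_min hΛ hN h₀ h₂ (hf.indicator measurableSet_ball)
    (fun x => Set.indicator_nonneg (fun x _ => hf0 x) x) (integrable_indicator_ball hf hf0 hfb)

theorem IsJumpMeasure.integrable_swap (hν : IsJumpMeasure σ Λ ν) {F : Euc N × Euc N → ℝ}
    (hF : Integrable F ν) : Integrable (fun z => F z.swap) ν :=
  hν.swap.integrable_comp_of_integrable hF

theorem IsJumpMeasure.integral_swap (hν : IsJumpMeasure σ Λ ν) (F : Euc N × Euc N → ℝ) :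
    ∫ z, F z.swap ∂ν = ∫ z, F z ∂ν :=
  hν.swap.integral_comp MeasurableEquiv.prodComm.measurableEmbedding F

/-- The difference vanishes unless one of the points is in the large ball. Charging it to that point
makes the bound integrable over the whole product space. -/
theorem IsCutoff.sq_sub_le_indicator (hψ : IsCutoff A x₀ R ψ) (x y : Euc N) :
    (ψ x - ψ y) ^ 2 ≤ A * ((Metric.ball x₀ (2 * R)).indicator (fun _ => 1) x * min 1 (‖x - y‖ ^ 2) +
      (Metric.ball x₀ (2 * R)).indicator (fun _ => 1) y * min 1 (‖y - x‖ ^ 2)) := by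
  have h := hψ.sq_sub_le x y
  have hA := hψ.const_nonneg
  have hm : 0 ≤ min 1 (‖x - y‖ ^ 2) := by positivity
  rw [norm_sub_rev y x]
  by_cases hx : x ∈ Metric.ball x₀ (2 * R) <;> by_cases hy : y ∈ Metric.ball x₀ (2 * R) <;>
    simp only [hx, hy, Set.indicator_of_mem, Set.indicator_of_notMem, not_false_eq_true]
  · nlinarith [mul_nonneg hA hm]
  · linarith
  · linarith
  · rw [hψ.eq_zero x hx, hψ.eq_zero y hy]; simp

theorem IsCutoff.memLp (hψ : IsCutoff A x₀ R ψ) (hν : IsJumpMeasure σ Λ ν) (hΛ : 0 < Λ)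
    (hN : 1 ≤ N) (h₀ : 0 < σ) (h₂ : σ < 2) :
    MemLp (fun z : Euc N × Euc N => ψ z.1 - ψ z.2) 2 ν := by
  have hm := hψ.measurable
  have hm2 : Measurable (fun z : Euc N × Euc N => ψ z.1 - ψ z.2) := by fun_prop
  rw [memLp_two_iff_integrable_sq hm2.aestronglyMeasurable]
  have hb := (hν.integrable_indicator_mul_min (f := fun _ => 1) (x₀ := x₀) (r := 2 * R) hΛ hN h₀ h₂
    measurable_const (by simp) (F := 1) (by simp)).1
  refine ((hb.add (hν.integrable_swap hb)).const_mul A).mono' (hm2.pow_const 2).aestronglyMeasurable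
    (Eventually.of_forall fun z => ?_)
  rw [Real.norm_of_nonneg (sq_nonneg _)]
  exact hψ.sq_sub_le_indicator z.1 z.2

theorem IsCutoff.memLp_sq (hψ : IsCutoff A x₀ R ψ) (hν : IsJumpMeasure σ Λ ν) (hΛ : 0 < Λ)
    (hN : 1 ≤ N) (h₀ : 0 < σ) (h₂ : σ < 2) :
    MemLp (fun z : Euc N × Euc N => ψ z.1 ^ 2 - ψ z.2 ^ 2) 2 ν := by
  have h := hψ.memLp hν hΛ hN h₀ h₂
  refine memLp_sub_of_le (f := fun x => ψ x ^ 2) (a := 1) (b := 1) (hψ.measurable.pow_const 2) h h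
    fun x y => ?_
  have h1 : |ψ x + ψ y| ≤ 2 := by
    rw [abs_of_nonneg (add_nonneg (hψ.nonneg x) (hψ.nonneg y))]
    linarith [hψ.le_one x, hψ.le_one y]
  have h2 : |ψ x ^ 2 - ψ y ^ 2| = |ψ x + ψ y| * |ψ x - ψ y| := by
    rw [← abs_mul]; congr 1; ring
  rw [h2]
  nlinarith [abs_nonneg (ψ x - ψ y)]

/-- The interaction energy of a nonnegative function with the square of a cutoff is controlled by
the mass of the function on the support of the cutoff. -/
theorem IsCutoff.integral_mul_sq_le (hψ : IsCutoff A x₀ R ψ) (hν : IsJumpMeasure σ Λ ν)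
    (hΛ : 0 < Λ) (hN : 1 ≤ N) (h₀ : 0 < σ) (h₂ : σ < 2) {F : ℝ} (hf : Measurable f)
    (hf0 : ∀ x, 0 ≤ f x) (hfb : ∀ x, f x ≤ F)
    (hfe : MemLp (fun z : Euc N × Euc N => f z.1 - f z.2) 2 ν) :
    ∫ z, (f z.1 - f z.2) * (ψ z.1 ^ 2 - ψ z.2 ^ 2) ∂ν ≤
      A * (Λ * (levyMoment N σ).toReal * ∫ x in Metric.ball x₀ (2 * R), f x) := by
  have hψm := hψ.measurable
  have hA := hψ.const_nonneg
  have hF : 0 ≤ F := (hf0 x₀).trans (hfb x₀)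
  have hint : Integrable (fun z : Euc N × Euc N => (f z.1 - f z.2) * (ψ z.1 ^ 2 - ψ z.2 ^ 2)) ν :=
    hfe.integrable_mul (hψ.memLp_sq hν hΛ hN h₀ h₂)
  obtain ⟨hbi, hb⟩ := hν.integrable_indicator_mul_min (x₀ := x₀) (r := 2 * R) hΛ hN h₀ h₂ hf hf0 hfb
  have h1i := (hν.integrable_indicator_mul_min (f := fun _ => 1) (x₀ := x₀) (r := 2 * R) hΛ hN h₀ h₂
    measurable_const (by simp) (F := 1) (by simp)).1
  have h1i' := hν.integrable_swap h1i
  -- The product splits into f(x)(ψ(x)² - ψ(y)²) and its swap, each only of first order in the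
  -- increment and possibly not integrable near the diagonal. Truncation away from the diagonal
  -- permits the splitting. The sets `S n` are invariant under swap and reflection.
  let S : ℕ → Set (Euc N × Euc N) := fun n => {z | 1 / ((n : ℝ) + 1) < ‖z.1 - z.2‖}
  have hS : ∀ n, MeasurableSet (S n) := fun n =>
    measurableSet_lt measurable_const (by fun_prop)
  have hmono : Monotone S := by
    intro m n hmn z hz
    have hz' : 1 / ((m : ℝ) + 1) < ‖z.1 - z.2‖ := hz
    have hmn' : (m : ℝ) ≤ n := by exact_mod_cast hmn
    exact lt_of_le_of_lt (one_div_le_one_div_of_le (by positivity) (by linarith)) hz'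
  have hlim := tendsto_setIntegral_of_monotone (μ := ν) hS hmono hint.integrableOn
  have hU : ∫ z in ⋃ n, S n, (f z.1 - f z.2) * (ψ z.1 ^ 2 - ψ z.2 ^ 2) ∂ν =
      ∫ z, (f z.1 - f z.2) * (ψ z.1 ^ 2 - ψ z.2 ^ 2) ∂ν := by
    rw [Measure.restrict_eq_self_of_ae_mem]
    filter_upwards [hν.absolutelyContinuous.ae_le (ae_fst_ne_snd hN)] with z hz
    obtain ⟨n, hn⟩ := exists_nat_one_div_lt (norm_pos_iff.2 (sub_ne_zero.2 hz))
    exact Set.mem_iUnion.2 ⟨n, hn⟩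
  rw [hU] at hlim
  refine le_of_tendsto' hlim fun n => ?_
  have hswap : MeasurePreserving Prod.swap (ν.restrict (S n)) (ν.restrict (S n)) := by
    have := hν.swap.restrict_preimage (hS n)
    have e : Prod.swap ⁻¹' S n = S n := by
      ext z; simp [S, norm_sub_rev z.2 z.1]
    rwa [e] at this
  have hrefl : MeasurePreserving reflectSnd (ν.restrict (S n)) (ν.restrict (S n)) := by
    have := hν.reflect.restrict_preimage (hS n)
    have e : reflectSnd ⁻¹' S n = S n := by
      ext z; simp [S, reflectSnd, norm_sub_rev z.2 z.1]
    rwa [e] at this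
  set G : Euc N × Euc N → ℝ := fun z => f z.1 * (ψ z.1 ^ 2 - ψ z.2 ^ 2) with hG
  have hsq1 : ∀ x, ψ x ^ 2 ≤ (Metric.ball x₀ (2 * R)).indicator (fun _ => 1) x := by
    intro x
    by_cases hx : x ∈ Metric.ball x₀ (2 * R)
    · rw [Set.indicator_of_mem hx]; nlinarith [hψ.nonneg x, hψ.le_one x]
    · rw [Set.indicator_of_notMem hx, hψ.eq_zero x hx]; simp
  have hGi : Integrable G (ν.restrict (S n)) := by
    have hGm : Measurable G := by rw [hG]; fun_prop
    refine (((h1i.add h1i').const_mul (F * ((n : ℝ) + 1) ^ 2)).restrict (s := S n)).mono'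
      hGm.aestronglyMeasurable ?_
    rw [ae_restrict_iff' (hS n)]
    refine Eventually.of_forall fun z hz => ?_
    have hz' : 1 / ((n : ℝ) + 1) < ‖z.1 - z.2‖ := hz
    have hn1 : (1 : ℝ) ≤ (n : ℝ) + 1 := by simp
    have hmin : 1 ≤ ((n : ℝ) + 1) ^ 2 * min 1 (‖z.1 - z.2‖ ^ 2) := by
      rw [mul_min_of_nonneg _ _ (by positivity), le_min_iff, ← mul_pow]
      rw [div_lt_iff₀ (by positivity), mul_comm] at hz'
      exact ⟨by nlinarith, one_le_pow₀ hz'.le⟩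
    simp only [Pi.add_apply, Prod.fst_swap, Prod.snd_swap, norm_sub_rev z.2 z.1]
    rw [hG, norm_mul, Real.norm_of_nonneg (hf0 _)]
    have hi1 : ‖ψ z.1 ^ 2 - ψ z.2 ^ 2‖ ≤ (Metric.ball x₀ (2 * R)).indicator (fun _ => 1) z.1 +
        (Metric.ball x₀ (2 * R)).indicator (fun _ => 1) z.2 := by
      rw [Real.norm_eq_abs, abs_le]
      constructor <;> linarith [hsq1 z.1, hsq1 z.2, sq_nonneg (ψ z.1), sq_nonneg (ψ z.2)]
    have hi0 : (0:ℝ) ≤ (Metric.ball x₀ (2 * R)).indicator (fun _ => 1) z.1 +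
        (Metric.ball x₀ (2 * R)).indicator (fun _ => 1) z.2 := (norm_nonneg _).trans hi1
    calc f z.1 * ‖ψ z.1 ^ 2 - ψ z.2 ^ 2‖
        ≤ F * ((Metric.ball x₀ (2 * R)).indicator (fun _ => 1) z.1 +
          (Metric.ball x₀ (2 * R)).indicator (fun _ => 1) z.2) := by gcongr; exact hfb _
      _ ≤ F * ((Metric.ball x₀ (2 * R)).indicator (fun _ => 1) z.1 +
          (Metric.ball x₀ (2 * R)).indicator (fun _ => 1) z.2) *
          (((n : ℝ) + 1) ^ 2 * min 1 (‖z.1 - z.2‖ ^ 2)) :=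
          le_mul_of_one_le_right (mul_nonneg hF hi0) hmin
      _ = _ := by ring
  have e1 : ∫ z in S n, (f z.1 - f z.2) * (ψ z.1 ^ 2 - ψ z.2 ^ 2) ∂ν =
      ∫ z in S n, G z ∂ν + ∫ z in S n, G z.swap ∂ν := by
    have hGs : Integrable (fun z => G z.swap) (ν.restrict (S n)) :=
      hswap.integrable_comp_of_integrable hGi
    rw [← integral_add hGi hGs]
    refine integral_congr_ae (Eventually.of_forall fun z => ?_)
    simp only [hG, Prod.fst_swap, Prod.snd_swap]; ring
  have e2 : ∫ z in S n, G z.swap ∂ν = ∫ z in S n, G z ∂ν :=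
    hswap.integral_comp MeasurableEquiv.prodComm.measurableEmbedding G
  have e3 : ∫ z in S n, G (reflectSnd z) ∂ν = ∫ z in S n, G z ∂ν :=
    hrefl.integral_comp measurableEmbedding_reflectSnd G
  have hGr : Integrable (fun z => G (reflectSnd z)) (ν.restrict (S n)) :=
    hrefl.integrable_comp_of_integrable hGi
  -- The swap gives twice the integral of `G`. Replacing one copy by its reflection turns the first
  -- difference of ψ² into a second difference, bounded by A min(1, |z|²) uniformly in n.
  rw [e1, e2]
  nth_rewrite 2 [← e3]
  rw [← integral_add hGi hGr]
  have hbn : ∀ z : Euc N × Euc N,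
      0 ≤ A * ((Metric.ball x₀ (2 * R)).indicator f z.1 * min 1 (‖z.1 - z.2‖ ^ 2)) := fun z =>
    mul_nonneg hA (mul_nonneg (Set.indicator_nonneg (fun x _ => hf0 x) _) (by positivity))
  calc ∫ z in S n, (G z + G (reflectSnd z)) ∂ν
      ≤ ∫ z in S n, A * ((Metric.ball x₀ (2 * R)).indicator f z.1 * min 1 (‖z.1 - z.2‖ ^ 2)) ∂ν := by
        refine integral_mono (hGi.add hGr) (hbi.const_mul A).restrict fun z => ?_
        have h2 := hψ.second_le z.1 (z.2 - z.1)
        rw [add_sub_cancel, norm_sub_rev] at h2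
        have e : G z + G (reflectSnd z) =
            f z.1 * (2 * ψ z.1 ^ 2 - ψ z.2 ^ 2 - ψ (z.1 - (z.2 - z.1)) ^ 2) := by
          simp only [hG, reflectSnd]; ring
        simp only [e]
        by_cases hx : z.1 ∈ Metric.ball x₀ (2 * R)
        · rw [Set.indicator_of_mem hx]
          calc _ ≤ f z.1 * (A * min 1 (‖z.1 - z.2‖ ^ 2)) := by gcongr; exact hf0 _
            _ = _ := by ring
        -- Outside the large ball ψ vanishes, so the second difference has the favourable sign and
        -- only the mass of f inside the ball counts.
        · rw [Set.indicator_of_notMem hx, hψ.eq_zero _ hx]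
          have : 0 ≤ f z.1 * (ψ z.2 ^ 2 + ψ (z.1 - (z.2 - z.1)) ^ 2) :=
            mul_nonneg (hf0 _) (by positivity)
          simp only [zero_mul, mul_zero]
          nlinarith
    _ ≤ ∫ z, A * ((Metric.ball x₀ (2 * R)).indicator f z.1 * min 1 (‖z.1 - z.2‖ ^ 2)) ∂ν :=
        setIntegral_le_integral (hbi.const_mul A) (Eventually.of_forall hbn)
    _ ≤ _ := by
        rw [integral_const_mul]
        gcongr

end Cutoff

/-! ### The two energy estimates: pointwise lower bound and interaction across a level. -/

section Energy

variable {N : ℕ} {σ Λ : ℝ}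
variable {ν : Measure (Euc N × Euc N)} {A R η W : ℝ} {x₀ : Euc N} {f g h w ψ : Euc N → ℝ}

theorem IsCutoff.sq_le_one (hψ : IsCutoff A x₀ R ψ) (x : Euc N) : ψ x ^ 2 ≤ 1 :=
  pow_le_one₀ (hψ.nonneg x) (hψ.le_one x)

theorem IsCutoff.hasCompactSupport_of_le (hψ : IsCutoff A x₀ R ψ) {v : Euc N → ℝ}
    (hv : ∀ x, ψ x = 0 → v x = 0) : HasCompactSupport v := by
  refine HasCompactSupport.of_support_subset_isCompact (isCompact_closedBall x₀ (2 * R)) ?_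
  intro x hx
  by_contra h
  exact hx (hv x (hψ.eq_zero x fun h' => h (Metric.ball_subset_closedBall h')))

theorem abs_posPart_sub_le (a b : ℝ) : |max a 0 - max b 0| ≤ |a - b| := by
  have := abs_max_sub_max_le_max a 0 b 0
  simpa using this

theorem IsBoundedSupersolution.integrableOn (hw : IsBoundedSupersolution ν η W w) (r : ℝ) :
    IntegrableOn w (Metric.ball x₀ r) :=
  (integrable_indicator_iff measurableSet_ball).1
    (integrable_indicator_ball hw.measurable hw.nonneg hw.le)

/-- If `w` is not above `t` on the ball of radius `R`, then its mass on the ball of radius `2R`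
is controlled by `t`. -/
theorem IsBoundedSupersolution.ae_le_of_mul_lt_integral (hw : IsBoundedSupersolution ν η W w)
    (hψ : IsCutoff A x₀ R ψ) (hν : IsJumpMeasure σ Λ ν) (hΛ : 0 < Λ) (hN : 1 ≤ N) (h₀ : 0 < σ)
    (h₂ : σ < 2) (hη : 0 ≤ η) (hR : 0 < R) {t : ℝ} (ht : 0 < t)
    (hlt : t * (volume.real (Metric.ball x₀ (2 * R)) + (4 * R) ^ ((N : ℝ) + σ) *
      (Λ * (A * (Λ * (levyMoment N σ).toReal) + 2 * η))) < ∫ x in Metric.ball x₀ (2 * R), w x) :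
    ∀ᵐ x ∂volume.restrict (Metric.ball x₀ R), t ≤ w x := by
  have hwm := hw.measurable
  have hψm := hψ.measurable
  set B := Metric.ball x₀ (2 * R) with hB
  have hBm : MeasurableSet B := measurableSet_ball
  -- The decomposition w = tψ² - v + q with qv = 0 underlies the whole estimate.
  set v : Euc N → ℝ := fun x => max (t * ψ x ^ 2 - w x) 0 with hv
  set q : Euc N → ℝ := fun x => max (w x - t * ψ x ^ 2) 0 with hq
  have hvm : Measurable v := by rw [hv]; fun_prop
  have hqm : Measurable q := by rw [hq]; fun_prop
  have hv0 : ∀ x, 0 ≤ v x := fun x => le_max_right _ _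
  have hq0 : ∀ x, 0 ≤ q x := fun x => le_max_right _ _
  have hvt : ∀ x, v x ≤ t := fun x => max_le
    (by nlinarith [hw.nonneg x, hψ.sq_le_one x]) ht.le
  have hqW : ∀ x, q x ≤ W := fun x => max_le
    (by nlinarith [hw.le x, sq_nonneg (ψ x)]) ((hw.nonneg x).trans (hw.le x))
  have hvz : ∀ x, ψ x = 0 → v x = 0 := fun x hx => by
    simp only [hv, hx]; rw [max_eq_right]; nlinarith [hw.nonneg x]
  have hwe : ∀ x, w x = t * ψ x ^ 2 - v x + q x := fun x => by
    simp only [hv, hq]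
    rcases le_total (w x) (t * ψ x ^ 2) with h | h
    · rw [max_eq_left (by linarith), max_eq_right (by linarith)]; ring
    · rw [max_eq_right (by linarith), max_eq_left (by linarith)]; ring
  have hvq : ∀ x, q x * v x = 0 := fun x => by
    simp only [hv, hq]
    rcases le_total (w x) (t * ψ x ^ 2) with h | h
    · rw [max_eq_right (a := w x - _) (by linarith)]; ring
    · rw [max_eq_right (a := t * _ - _) (by linarith)]; ring
  have hφe := hψ.memLp_sq hν hΛ hN h₀ h₂
  have hdiff : ∀ x y, |t * ψ x ^ 2 - w x - (t * ψ y ^ 2 - w y)| ≤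
      t * |ψ x ^ 2 - ψ y ^ 2| + 1 * |w x - w y| := fun x y => by
    have e : t * ψ x ^ 2 - w x - (t * ψ y ^ 2 - w y) =
      t * (ψ x ^ 2 - ψ y ^ 2) - (w x - w y) := by ring
    rw [e, one_mul]
    refine (abs_sub _ _).trans ?_
    rw [abs_mul, abs_of_pos ht]
  have hve : MemLp (fun z : Euc N × Euc N => v z.1 - v z.2) 2 ν :=
    memLp_sub_of_le (g := fun x => ψ x ^ 2) (h := w) hvm hφe hw.memLp fun x y =>
      (abs_posPart_sub_le _ _).trans (hdiff x y)
  have hqe : MemLp (fun z : Euc N × Euc N => q z.1 - q z.2) 2 ν :=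
    memLp_sub_of_le (g := fun x => ψ x ^ 2) (h := w) hqm hφe hw.memLp fun x y => by
      refine (abs_posPart_sub_le _ _).trans (le_trans (le_of_eq ?_) (hdiff x y))
      rw [← abs_neg]; congr 1; ring
  have htest := hw.test v hvm hv0 ⟨t, hvt⟩ (hψ.hasCompactSupport_of_le hvz) hve
  have hvi : Integrable v := integrable_of_bounded_compactSupport (V := t) hvm
    (fun x => by rw [abs_of_nonneg (hv0 x)]; exact hvt x) (hψ.hasCompactSupport_of_le hvz)
  have hwv : ∫ x, w x * v x ≤ t * ∫ x, v x := by
    rw [← integral_const_mul]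
    refine integral_mono_of_nonneg (Eventually.of_forall fun x => mul_nonneg (hw.nonneg x) (hv0 x))
      (hvi.const_mul t) (Eventually.of_forall fun x => ?_)
    have h1 := hwe x
    have h2 := hvq x
    rcases eq_or_lt_of_le (hv0 x) with h | h
    · simp [← h]
    · have hq' : q x = 0 := by
        rcases mul_eq_zero.1 h2 with h' | h'
        · exact h'
        · exact absurd h' h.ne'
      have : w x ≤ t := by nlinarith [hψ.sq_le_one x]
      exact mul_le_mul_of_nonneg_right this h.le
  have hvB : ∫ x in B, v x = ∫ x, v x :=
    setIntegral_eq_integral_of_forall_compl_eq_zero fun x hx => hvz x (hψ.eq_zero x hx)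
  have hform := hψ.integral_mul_sq_le hν hΛ hN h₀ h₂ hvm hv0 hvt hve
  rw [← hB, hvB] at hform
  have hvφi : Integrable (fun z : Euc N × Euc N =>
      (v z.1 - v z.2) * (ψ z.1 ^ 2 - ψ z.2 ^ 2)) ν := hve.integrable_mul hφe
  have hwvi : Integrable (fun z : Euc N × Euc N => (w z.1 - w z.2) * (v z.1 - v z.2)) ν :=
    hw.memLp.integrable_mul hve
  have hqvi : Integrable (fun z : Euc N × Euc N => q z.1 * v z.2 + q z.2 * v z.1) ν := by
    refine (hqe.integrable_mul hve).neg.congr (Eventually.of_forall fun z => ?_)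
    simp only [Pi.neg_apply, Pi.mul_apply]
    linear_combination -(hvq z.1) - hvq z.2
  have hmain : ∫ z, (q z.1 * v z.2 + q z.2 * v z.1) ∂ν ≤
      t * (A * (Λ * (levyMoment N σ).toReal) + 2 * η) * ∫ x, v x := by
    have h1 : ∫ z, (q z.1 * v z.2 + q z.2 * v z.1) ∂ν ≤
        ∫ z, (t * ((v z.1 - v z.2) * (ψ z.1 ^ 2 - ψ z.2 ^ 2)) -
          (w z.1 - w z.2) * (v z.1 - v z.2)) ∂ν := by
      -- Since qv = 0, the product of the increments of q and v is exactly minus the cross term; the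
      -- only thing discarded is the square of the increment of v.
      refine integral_mono hqvi ((hvφi.const_mul t).sub hwvi) fun z => ?_
      simp only
      rw [hwe z.1, hwe z.2]
      nlinarith [sq_nonneg (v z.1 - v z.2), hvq z.1, hvq z.2]
    rw [integral_sub (hvφi.const_mul t) hwvi, integral_const_mul] at h1
    have h2 := mul_le_mul_of_nonneg_left hform ht.le
    have h3 := mul_le_mul_of_nonneg_left hwv hη
    nlinarith
  have hlow := hν.setLIntegral_le hΛ hN h₀ (F := fun z => q z.1 * v z.2 + q z.2 * v z.1)
    (by fun_prop) (fun z => add_nonneg (mul_nonneg (hq0 _) (hv0 _)) (mul_nonneg (hq0 _) (hv0 _)))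
    hqvi (hBm.prod hBm) (d := 4 * R) (fun z hz => by
      have h1 := hz.1
      have h2 := hz.2
      rw [hB, Metric.mem_ball] at h1 h2
      rw [← dist_eq_norm]
      linarith [dist_triangle_right z.1 z.2 x₀])
  have hqB : IntegrableOn q B := by
    have := integrable_indicator_ball (x₀ := x₀) (r := 2 * R) hqm hq0 hqW
    rwa [integrable_indicator_iff measurableSet_ball] at this
  have hprod : ENNReal.ofReal ((∫ x in B, q x) * ∫ x, v x) ≤
      ∫⁻ z in B ×ˢ B, ENNReal.ofReal (q z.1 * v z.2 + q z.2 * v z.1) := by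
    rw [ENNReal.ofReal_mul (integral_nonneg hq0), ← hvB,
      ofReal_integral_eq_lintegral_ofReal hqB (Eventually.of_forall hq0),
      ofReal_integral_eq_lintegral_ofReal hvi.integrableOn (Eventually.of_forall hv0),
      Measure.volume_eq_prod, ← Measure.prod_restrict,
      ← lintegral_prod_mul (by fun_prop) (by fun_prop)]
    refine lintegral_mono fun z => ?_
    rw [← ENNReal.ofReal_mul (hq0 _)]
    exact ENNReal.ofReal_le_ofReal (le_add_of_nonneg_right (mul_nonneg (hq0 _) (hv0 _)))
  have hRp : 0 < (4 * R) ^ ((N : ℝ) + σ) := Real.rpow_pos_of_pos (by positivity) _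
  have hI0 : 0 ≤ ∫ x, v x := integral_nonneg hv0
  have hfin : (∫ x in B, q x) * (∫ x, v x) ≤ (4 * R) ^ ((N : ℝ) + σ) *
      (Λ * (t * (A * (Λ * (levyMoment N σ).toReal) + 2 * η) * ∫ x, v x)) := by
    have h1 := (mul_le_mul_right hprod _).trans hlow
    rw [← ENNReal.ofReal_mul (by positivity), ENNReal.ofReal_le_ofReal_iff (mul_nonneg hΛ.le
      (integral_nonneg fun z => add_nonneg (mul_nonneg (hq0 _) (hv0 _))
        (mul_nonneg (hq0 _) (hv0 _)))), one_div, inv_mul_le_iff₀ hRp] at h1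
    exact h1.trans (by gcongr)
  have hwq : ∫ x in B, w x ≤ (∫ x in B, q x) + t * volume.real B := by
    have h1 : ∫ x in B, w x ≤ ∫ x in B, (q x + t) := by
      refine integral_mono (hw.integrableOn _)
        (hqB.add (integrableOn_const measure_ball_lt_top.ne)) fun x => ?_
      simp only
      have h1 := hwe x
      nlinarith [hψ.sq_le_one x, hv0 x]
    rw [integral_add hqB (integrableOn_const measure_ball_lt_top.ne), setIntegral_const,
      smul_eq_mul, mul_comm _ t] at h1
    exact h1
  -- Both sides of `hfin` carry the factor ∫ v. If it were positive it would cancel, leaving a bound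
  -- on the mass of q, hence on that of w, which contradicts the size of t.
  have hzero : ∫ x, v x = 0 := by
    by_contra hne
    have hpos : 0 < ∫ x, v x := lt_of_le_of_ne hI0 (Ne.symm hne)
    have : ∫ x in B, q x ≤ (4 * R) ^ ((N : ℝ) + σ) *
        (Λ * (t * (A * (Λ * (levyMoment N σ).toReal) + 2 * η))) := by
      refine le_of_mul_le_mul_right (hfin.trans (le_of_eq ?_)) hpos
      ring
    linarith
  rw [integral_eq_zero_iff_of_nonneg hv0 hvi] at hzero
  rw [ae_restrict_iff' measurableSet_ball]
  filter_upwards [hzero] with x hx hxB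
  have h1 := hwe x
  rw [hψ.eq_one x hxB, hx] at h1
  simp only [Pi.zero_apply] at h1
  linarith [hq0 x]

/-- Interaction of the part of `w` above the level `k` with the part below. -/
theorem IsBoundedSupersolution.integral_level_le (hw : IsBoundedSupersolution ν η W w)
    (hψ : IsCutoff A x₀ R ψ) (hν : IsJumpMeasure σ Λ ν) (hΛ : 0 < Λ) (hN : 1 ≤ N) (h₀ : 0 < σ)
    (h₂ : σ < 2) (hη : 0 ≤ η) {k : ℝ} (hk : 0 < k) :
    Integrable (fun z : Euc N × Euc N => max (w z.1 - k) 0 * (max (k - w z.2) 0 * ψ z.2 ^ 2) +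
      max (w z.2 - k) 0 * (max (k - w z.1) 0 * ψ z.1 ^ 2)) ν ∧
    ∫ z, (max (w z.1 - k) 0 * (max (k - w z.2) 0 * ψ z.2 ^ 2) +
      max (w z.2 - k) 0 * (max (k - w z.1) 0 * ψ z.1 ^ 2)) ∂ν ≤
      k * (3 * A * (Λ * (levyMoment N σ).toReal) + 2 * η) *
        ∫ x in Metric.ball x₀ (2 * R), w x := by
  have hwm := hw.measurable
  have hψm := hψ.measurable
  have hA := hψ.const_nonneg
  set B := Metric.ball x₀ (2 * R) with hB
  set G : Euc N → ℝ := fun x => max (w x - k) 0 with hG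
  set H : Euc N → ℝ := fun x => max (k - w x) 0 with hH
  set g : Euc N → ℝ := fun x => min (w x) k with hg
  set v : Euc N → ℝ := fun x => H x * ψ x ^ 2 with hv
  have hGm : Measurable G := by rw [hG]; fun_prop
  have hHm : Measurable H := by rw [hH]; fun_prop
  have hgm : Measurable g := by rw [hg]; fun_prop
  have hvm : Measurable v := by rw [hv]; fun_prop
  have hH0 : ∀ x, 0 ≤ H x := fun x => le_max_right _ _
  have hHk : ∀ x, H x ≤ k := fun x => max_le (by linarith [hw.nonneg x]) hk.le
  have hg0 : ∀ x, 0 ≤ g x := fun x => le_min (hw.nonneg x) hk.le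
  have hgk : ∀ x, g x ≤ k := fun x => min_le_right _ _
  have hgw : ∀ x, g x ≤ w x := fun x => min_le_left _ _
  have hwe : ∀ x, w x = g x + G x := fun x => by
    simp only [hg, hG]
    rcases le_total (w x) k with h | h
    · rw [min_eq_left h, max_eq_right (by linarith)]; ring
    · rw [min_eq_right h, max_eq_left (by linarith)]; ring
  have hHe : ∀ x, H x = k - g x := fun x => by
    simp only [hg, hH]
    rcases le_total (w x) k with h | h
    · rw [min_eq_left h, max_eq_left (by linarith)]
    · rw [min_eq_right h, max_eq_right (by linarith)]; ring
  have hGH : ∀ x, G x * H x = 0 := fun x => by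
    simp only [hG, hH]
    rcases le_total (w x) k with h | h
    · rw [max_eq_right (a := w x - k) (by linarith)]; ring
    · rw [max_eq_right (a := k - w x) (by linarith)]; ring
  have hv0 : ∀ x, 0 ≤ v x := fun x => mul_nonneg (hH0 x) (sq_nonneg _)
  have hvk : ∀ x, v x ≤ k := fun x =>
    (mul_le_of_le_one_right (hH0 x) (hψ.sq_le_one x)).trans (hHk x)
  have hvz : ∀ x, ψ x = 0 → v x = 0 := fun x hx => by simp [hv, hx]
  have hφe := hψ.memLp_sq hν hΛ hN h₀ h₂
  have hHd : ∀ x y, |H x - H y| ≤ |w x - w y| := fun x y => by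
    refine (abs_posPart_sub_le _ _).trans (le_of_eq ?_)
    rw [← abs_neg]; congr 1; ring
  have hge : MemLp (fun z : Euc N × Euc N => g z.1 - g z.2) 2 ν :=
    memLp_sub_of_le (g := w) (h := w) (a := 1) (b := 0) hgm hw.memLp hw.memLp fun x y => by
      have h := hHd x y
      rw [hHe, hHe, ← abs_neg] at h
      simp only [one_mul, zero_mul, add_zero]
      refine le_trans (le_of_eq ?_) h
      congr 1; ring
  have hGe : MemLp (fun z : Euc N × Euc N => G z.1 - G z.2) 2 ν :=
    memLp_sub_of_le (g := w) (h := w) (a := 1) (b := 0) hGm hw.memLp hw.memLp fun x y => by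
      refine (abs_posPart_sub_le _ _).trans (le_of_eq ?_)
      simp
  have hve : MemLp (fun z : Euc N × Euc N => v z.1 - v z.2) 2 ν :=
    memLp_sub_of_le (g := fun x => ψ x ^ 2) (h := w) (a := k) (b := 1) hvm hφe hw.memLp
      fun x y => by
        have e : v x - v y = H x * (ψ x ^ 2 - ψ y ^ 2) + ψ y ^ 2 * (H x - H y) := by
          simp only [hv]; ring
        rw [e]
        refine (abs_add_le _ _).trans (add_le_add ?_ ?_)
        · rw [abs_mul, abs_of_nonneg (hH0 x)]
          exact mul_le_mul_of_nonneg_right (hHk x) (abs_nonneg _)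
        · rw [abs_mul, abs_of_nonneg (sq_nonneg (ψ y))]
          exact mul_le_mul (hψ.sq_le_one y) (hHd x y) (abs_nonneg _) zero_le_one
  have hcs := hψ.hasCompactSupport_of_le hvz
  have htest := hw.test v hvm hv0 ⟨k, hvk⟩ hcs hve
  have hwB : IntegrableOn w B := hw.integrableOn _
  have hgB : ∫ x in B, g x ≤ ∫ x in B, w x :=
    integral_mono_of_nonneg (Eventually.of_forall hg0) hwB (Eventually.of_forall hgw)
  have hwv : ∫ x, w x * v x ≤ k * ∫ x in B, w x := by
    rw [← integral_const_mul, ← setIntegral_eq_integral_of_forall_compl_eq_zero (s := B)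
      (fun x hx => by rw [hvz x (hψ.eq_zero x hx), mul_zero])]
    refine integral_mono_of_nonneg
      (Eventually.of_forall fun x => mul_nonneg (hw.nonneg x) (hv0 x))
      (hwB.const_mul k) (Eventually.of_forall fun x => ?_)
    simp only
    rw [mul_comm k]
    exact mul_le_mul_of_nonneg_left (hvk x) (hw.nonneg x)
  have hform := hψ.integral_mul_sq_le hν hΛ hN h₀ h₂ hgm hg0 hgk hge
  obtain ⟨hbi, hb⟩ := hν.integrable_indicator_mul_min (x₀ := x₀) (r := 2 * R) hΛ hN h₀ h₂ hgm hg0 hgk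
  have hbi' := hν.integrable_swap hbi
  have hb' := hν.integral_swap fun z : Euc N × Euc N =>
    (Metric.ball x₀ (2 * R)).indicator g z.1 * min 1 (‖z.1 - z.2‖ ^ 2)
  rw [← hB] at hform hb hbi hbi' hb'
  have hgφi : Integrable (fun z : Euc N × Euc N =>
      (g z.1 - g z.2) * (ψ z.1 ^ 2 - ψ z.2 ^ 2)) ν := hge.integrable_mul hφe
  have hwvi : Integrable (fun z : Euc N × Euc N => (w z.1 - w z.2) * (v z.1 - v z.2)) ν :=
    hw.memLp.integrable_mul hve
  have hGvi : Integrable (fun z : Euc N × Euc N => G z.1 * v z.2 + G z.2 * v z.1) ν := by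
    refine (hGe.integrable_mul hve).neg.congr (Eventually.of_forall fun z => ?_)
    simp only [Pi.neg_apply, Pi.mul_apply, hv]
    linear_combination -(ψ z.1 ^ 2 * hGH z.1) - ψ z.2 ^ 2 * hGH z.2
  refine ⟨hGvi, ?_⟩
  -- One factor g is bounded by k and the other is kept at a point of the ball, so that the result
  -- is again linear in the mass. Its two symmetric terms contribute 2A of the constant 3A.
  have hcut : ∀ z : Euc N × Euc N, g z.1 * g z.2 * (ψ z.1 - ψ z.2) ^ 2 ≤
      k * A * (B.indicator g z.1 * min 1 (‖z.1 - z.2‖ ^ 2) +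
        B.indicator g z.swap.1 * min 1 (‖z.swap.1 - z.swap.2‖ ^ 2)) := by
    intro z
    have h1 := hψ.sq_sub_le z.1 z.2
    have hm : 0 ≤ min 1 (‖z.1 - z.2‖ ^ 2) := by positivity
    simp only [Prod.fst_swap, Prod.snd_swap, norm_sub_rev z.2 z.1]
    have hi : ∀ x, 0 ≤ B.indicator g x := fun x => Set.indicator_nonneg (fun x _ => hg0 x) x
    have hi1 := hi z.1
    have hi2 := hi z.2
    by_cases hx : z.1 ∈ B
    · rw [Set.indicator_of_mem hx]
      calc g z.1 * g z.2 * (ψ z.1 - ψ z.2) ^ 2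
          ≤ g z.1 * k * (A * min 1 (‖z.1 - z.2‖ ^ 2)) := by
            gcongr
            · exact mul_nonneg (hg0 _) hk.le
            · exact hg0 _
            · exact hgk _
        _ = k * A * (g z.1 * min 1 (‖z.1 - z.2‖ ^ 2) + 0) := by ring
        _ ≤ _ := by gcongr; exact mul_nonneg hi2 hm
    · by_cases hy : z.2 ∈ B
      · rw [Set.indicator_of_mem hy]
        calc g z.1 * g z.2 * (ψ z.1 - ψ z.2) ^ 2
            ≤ k * g z.2 * (A * min 1 (‖z.1 - z.2‖ ^ 2)) := by
              gcongr
              · exact mul_nonneg hk.le (hg0 _)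
              · exact hg0 _
              · exact hgk _
          _ = k * A * (0 + g z.2 * min 1 (‖z.1 - z.2‖ ^ 2)) := by ring
          _ ≤ _ := by gcongr; exact mul_nonneg hi1 hm
      · rw [hψ.eq_zero _ hx, hψ.eq_zero _ hy]
        simp only [sub_self, ne_eq, OfNat.ofNat_ne_zero, not_false_eq_true, zero_pow, mul_zero]
        positivity
  have hs : Integrable (fun z : Euc N × Euc N => k * A *
      (B.indicator g z.1 * min 1 (‖z.1 - z.2‖ ^ 2) +
        B.indicator g z.swap.1 * min 1 (‖z.swap.1 - z.swap.2‖ ^ 2))) ν :=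
    (hbi.add hbi').const_mul (k * A)
  have hs' : Integrable (fun z : Euc N × Euc N =>
      k * ((g z.1 - g z.2) * (ψ z.1 ^ 2 - ψ z.2 ^ 2)) + k * A *
      (B.indicator g z.1 * min 1 (‖z.1 - z.2‖ ^ 2) +
        B.indicator g z.swap.1 * min 1 (‖z.swap.1 - z.swap.2‖ ^ 2))) ν :=
    (hgφi.const_mul k).add hs
  have h1 : ∫ z, (G z.1 * v z.2 + G z.2 * v z.1) ∂ν ≤
      ∫ z, (k * ((g z.1 - g z.2) * (ψ z.1 ^ 2 - ψ z.2 ^ 2)) +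
        k * A * (B.indicator g z.1 * min 1 (‖z.1 - z.2‖ ^ 2) +
        B.indicator g z.swap.1 * min 1 (‖z.swap.1 - z.swap.2‖ ^ 2)) -
        (w z.1 - w z.2) * (v z.1 - v z.2)) ∂ν := by
    refine integral_mono hGvi (hs'.sub hwvi) fun z => ?_
    have h1 := hcut z
    -- A Caccioppoli identity: with v = (k - g)ψ², the product of the increments of g and gψ² equals
    -- the squared increment of gψ minus g(x)g(y)(ψ(x) - ψ(y))². The square has a good sign and is
    -- dropped.
    have e : G z.1 * v z.2 + G z.2 * v z.1 =
        k * ((g z.1 - g z.2) * (ψ z.1 ^ 2 - ψ z.2 ^ 2)) +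
        (g z.1 * g z.2 * (ψ z.1 - ψ z.2) ^ 2 - (g z.1 * ψ z.1 - g z.2 * ψ z.2) ^ 2) -
        (w z.1 - w z.2) * (v z.1 - v z.2) := by
      have e1 := hGH z.1
      have e2 := hGH z.2
      simp only [hv]
      rw [hwe z.1, hwe z.2]
      rw [hHe] at e1 e2 ⊢
      rw [hHe]
      linear_combination ψ z.1 ^ 2 * e1 + ψ z.2 ^ 2 * e2
    simp only [e]
    linarith [sq_nonneg (g z.1 * ψ z.1 - g z.2 * ψ z.2)]
  rw [integral_sub hs' hwvi, integral_add (hgφi.const_mul k) hs, integral_const_mul,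
    integral_const_mul, integral_add hbi hbi', hb'] at h1
  have hT : 0 ≤ Λ * (levyMoment N σ).toReal := by positivity
  have c1 : k * ∫ z, (g z.1 - g z.2) * (ψ z.1 ^ 2 - ψ z.2 ^ 2) ∂ν ≤
      k * (A * (Λ * (levyMoment N σ).toReal * ∫ x in B, w x)) := by
    refine mul_le_mul_of_nonneg_left (hform.trans ?_) hk.le
    gcongr
  have c2 := mul_le_mul_of_nonneg_left (hb.trans (mul_le_mul_of_nonneg_left hgB hT))
    (mul_nonneg hk.le hA)
  have c3 := mul_le_mul_of_nonneg_left hwv hη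
  nlinarith

end Energy

/-! ### Existence of cutoffs at every scale R ≥ 1. -/

section CutoffExistence

variable {N : ℕ} {σ Λ : ℝ}

/-- The derivative is Lipschitz, so the first-order Taylor remainder is quadratic; in the symmetric
difference the linear terms cancel. -/
theorem exists_second_difference_le {E : Type*} [NormedAddCommGroup E] [NormedSpace ℝ E]
    {f : E → ℝ} (hf : ContDiff ℝ 2 f) (hfc : HasCompactSupport f) :
    ∃ C : ℝ, 0 ≤ C ∧ ∀ x z, 2 * f x - f (x + z) - f (x - z) ≤ C * ‖z‖ ^ 2 := by
  obtain ⟨L, hL⟩ := ContDiff.lipschitzWith_of_hasCompactSupport (hfc.fderiv (𝕜 := ℝ))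
    (hf.fderiv_right (m := 1) (by norm_num)) one_ne_zero
  have hd : Differentiable ℝ f := hf.differentiable two_ne_zero
  have key : ∀ x z, |f (x + z) - f x - fderiv ℝ f x z| ≤ L * ‖z‖ ^ 2 := by
    intro x z
    have h := (convex_closedBall x ‖z‖).norm_image_sub_le_of_norm_fderiv_le' (𝕜 := ℝ) (f := f)
      (φ := fderiv ℝ f x) (C := L * ‖z‖) (x := x) (y := x + z) (fun y _ => hd y)
      (fun y hy => by
        have h1 := hL.dist_le_mul y x
        rw [dist_eq_norm] at h1
        exact h1.trans (mul_le_mul_of_nonneg_left hy L.2))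
      (by simp) (by simp)
    rw [add_sub_cancel_left, Real.norm_eq_abs] at h
    linarith [h, sq (‖z‖)]
  refine ⟨2 * L, by positivity, fun x z => ?_⟩
  have h1 := abs_le.1 (key x z)
  have h2 := abs_le.1 (key x (-z))
  rw [norm_neg, map_neg, ← sub_eq_add_neg] at h2
  linarith [h1.1, h2.1]

/-- Cutoff functions with uniform bounds at all scales `R ≥ 1`. -/
theorem exists_isCutoff (N : ℕ) :
    ∃ A : ℝ, ∀ (x₀ : Euc N) (R : ℝ), 1 ≤ R → ∃ ψ, IsCutoff A x₀ R ψ := by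
  let b : ContDiffBump (0 : Euc N) := ⟨1, 2, one_pos, one_lt_two⟩
  have hbc : HasCompactSupport b := b.hasCompactSupport
  obtain ⟨L, hL⟩ := ContDiff.lipschitzWith_of_hasCompactSupport hbc (b.contDiff (n := 1)) one_ne_zero
  obtain ⟨C, hC, hC2⟩ := exists_second_difference_le (f := fun x => b x ^ 2)
    ((b.contDiff (n := 2)).pow 2) (hbc.comp_left (g := fun t : ℝ => t ^ 2) (by simp))
  have hb0 : ∀ x, 0 ≤ b x := fun x => b.nonneg
  have hb1 : ∀ x, b x ≤ 1 := fun x => b.le_one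
  refine ⟨2 + (L : ℝ) ^ 2 + C, fun x₀ R hR => ⟨fun x => b (R⁻¹ • (x - x₀)), ?_⟩⟩
  have hR0 : 0 < R := by linarith
  -- Rescaling one fixed bump contracts distances when R ≥ 1, which is why a single A serves all
  -- these scales.
  have hRi : R⁻¹ ≤ 1 := inv_le_one_of_one_le₀ hR
  have hnorm : ∀ z : Euc N, ‖R⁻¹ • z‖ ≤ ‖z‖ := fun z => by
    rw [norm_smul, Real.norm_of_nonneg (by positivity)]
    exact mul_le_of_le_one_left (norm_nonneg _) hRi
  have hscale : ∀ (x : Euc N) (r : ℝ), ‖R⁻¹ • (x - x₀)‖ < r ↔ dist x x₀ < r * R := fun x r => by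
    rw [norm_smul, Real.norm_of_nonneg (by positivity), dist_eq_norm, inv_mul_lt_iff₀ hR0,
      mul_comm r]
  refine ⟨?_, by positivity, fun x => hb0 _, fun x => hb1 _, fun x hx => ?_, fun x hx => ?_,
    fun x y => ?_, fun x z => ?_⟩
  · exact (b.continuous.comp (by fun_prop)).measurable
  · refine b.one_of_mem_closedBall ?_
    rw [mem_closedBall_zero_iff]
    exact ((hscale x 1).2 (by rwa [one_mul])).le
  · have : R⁻¹ • (x - x₀) ∉ Function.support b := by
      rw [b.support_eq, mem_ball_zero_iff]
      exact fun h => hx ((hscale x 2).1 h)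
    simpa using this
  · rw [mul_min_of_nonneg _ _ (by positivity), le_min_iff]
    set a := b (R⁻¹ • (x - x₀)) with ha
    set c := b (R⁻¹ • (y - x₀)) with hc
    have h1 : |a - c| ≤ L * ‖x - y‖ := by
      have h := hL.dist_le_mul (R⁻¹ • (x - x₀)) (R⁻¹ • (y - x₀))
      rw [Real.dist_eq, dist_eq_norm, ← smul_sub, sub_sub_sub_cancel_right] at h
      exact h.trans (mul_le_mul_of_nonneg_left (hnorm _) L.2)
    have h2 : |a - c| ≤ 1 := by
      rw [abs_le]; constructor <;> linarith [hb0 (R⁻¹ • (x - x₀)), hb1 (R⁻¹ • (x - x₀)),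
        hb0 (R⁻¹ • (y - x₀)), hb1 (R⁻¹ • (y - x₀))]
    have h3 := pow_le_pow_left₀ (abs_nonneg _) h1 2
    have h4 := pow_le_pow_left₀ (abs_nonneg _) h2 2
    rw [sq_abs] at h3 h4
    constructor
    · nlinarith [sq_nonneg (L : ℝ)]
    · refine h3.trans ?_
      rw [mul_pow]
      gcongr
      linarith
  · rw [mul_min_of_nonneg _ _ (by positivity), le_min_iff]
    have h := hC2 (R⁻¹ • (x - x₀)) (R⁻¹ • z)
    have e1 : R⁻¹ • (x + z - x₀) = R⁻¹ • (x - x₀) + R⁻¹ • z := by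
      rw [← smul_add]; congr 1; abel
    have e2 : R⁻¹ • (x - z - x₀) = R⁻¹ • (x - x₀) - R⁻¹ • z := by
      rw [← smul_sub]; congr 1; abel
    rw [e1, e2]
    constructor
    · have := pow_le_one₀ (n := 2) (hb0 (R⁻¹ • (x - x₀))) (hb1 _)
      nlinarith [sq_nonneg (b (R⁻¹ • (x - x₀) + R⁻¹ • z)),
        sq_nonneg (b (R⁻¹ • (x - x₀) - R⁻¹ • z)), sq_nonneg (L : ℝ)]
    · refine h.trans ?_
      gcongr
      · nlinarith [sq_nonneg (L : ℝ)]
      · exact hnorm z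

end CutoffExistence

/-! ### Decay of superlevel sets at one scale. -/

section Levels

variable {N : ℕ} {σ Λ : ℝ}
variable {ν : Measure (Euc N × Euc N)} {A R η W : ℝ} {x₀ : Euc N} {w ψ : Euc N → ℝ}

/-- Even near the boundary, a point has a ball of radius ρ/2 nearby inside the large ball: shift the
centre from x towards x₀ by the fraction ρ/(2R), a displacement of at most ρ/2. -/
theorem exists_ball_subset_inter {x : Euc N} {ρ : ℝ} (hx : x ∈ Metric.ball x₀ R) (hρ : 0 < ρ)
    (hρR : ρ ≤ R) :
    ∃ c, Metric.ball c (ρ / 2) ⊆ Metric.ball x₀ R ∩ Metric.closedBall x ρ := by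
  have hR : 0 < R := hρ.trans_le hρR
  rw [mem_ball_iff_norm] at hx
  refine ⟨x - (ρ / (2 * R)) • (x - x₀), fun y hy => ?_⟩
  rw [mem_ball_iff_norm] at hy
  have h2 : ρ / (2 * R) * R = ρ / 2 := by field_simp
  have h1 : ρ / (2 * R) ≤ 1 := by rw [div_le_one (by positivity)]; linarith
  have h0 : 0 ≤ ρ / (2 * R) := by positivity
  constructor
  · rw [mem_ball_iff_norm]
    have e : y - x₀ = (y - (x - (ρ / (2 * R)) • (x - x₀))) + (1 - ρ / (2 * R)) • (x - x₀) := by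
      rw [sub_smul, one_smul]; abel
    rw [e]
    refine (norm_add_le _ _).trans_lt ?_
    rw [norm_smul, Real.norm_of_nonneg (by linarith)]
    nlinarith
  · rw [mem_closedBall_iff_norm]
    have e : y - x = (y - (x - (ρ / (2 * R)) • (x - x₀))) + -((ρ / (2 * R)) • (x - x₀)) := by
      abel
    rw [e]
    refine (norm_add_le _ _).trans ?_
    rw [norm_neg, norm_smul, Real.norm_of_nonneg h0]
    nlinarith

theorem volume_ball_euc (hN : 1 ≤ N) (x : Euc N) {r : ℝ} (hr : 0 ≤ r) : volume (Metric.ball x r) =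
    ENNReal.ofReal (volume.real (Metric.ball (0 : Euc N) 1) * r ^ N) := by
  have := nontrivial_euc hN
  rw [Measure.addHaar_ball _ _ hr, finrank_euclideanSpace_fin, mul_comm,
    ENNReal.ofReal_mul measureReal_nonneg, ofReal_measureReal measure_ball_lt_top.ne]

/-- Points of a ball see a large part of the complement of a small subset. -/
theorem volume_prod_ge (hN : 1 ≤ N) {S₁ S₂ : Set (Euc N)} (hS₁ : MeasurableSet S₁) (hS₂ : MeasurableSet S₂)
    (hsub : S₁ ⊆ Metric.ball x₀ R) {ρ : ℝ} (hρ : 0 < ρ) (hρR : ρ ≤ R) {m : ℝ} (hm : 0 ≤ m)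
    (hm2 : 2 * m ≤ volume.real (Metric.ball (0 : Euc N) 1) * (ρ / 2) ^ N)
    (hS₂m : volume S₂ ≤ ENNReal.ofReal m) :
    ENNReal.ofReal m * volume S₁ ≤ volume {z : Euc N × Euc N |
      z.1 ∈ S₁ ∧ z.2 ∈ Metric.ball x₀ R \ S₂ ∧ ‖z.1 - z.2‖ ≤ ρ} := by
  have hZ : MeasurableSet {z : Euc N × Euc N |
      z.1 ∈ S₁ ∧ z.2 ∈ Metric.ball x₀ R \ S₂ ∧ ‖z.1 - z.2‖ ≤ ρ} :=
    (measurable_fst hS₁).inter ((measurable_snd (measurableSet_ball.diff hS₂)).inter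
      (measurableSet_le (f := fun z : Euc N × Euc N => ‖z.1 - z.2‖) (by fun_prop)
        measurable_const))
  rw [Measure.volume_eq_prod, Measure.prod_apply hZ, ← setLIntegral_const]
  refine (setLIntegral_mono_ae' hS₁ (Eventually.of_forall fun x hx => ?_)).trans
    (setLIntegral_le_lintegral S₁ _)
  obtain ⟨c, hc⟩ := exists_ball_subset_inter (hsub hx) hρ hρR
  have h1 : Metric.ball c (ρ / 2) \ S₂ ⊆ Prod.mk x ⁻¹' {z : Euc N × Euc N |
      z.1 ∈ S₁ ∧ z.2 ∈ Metric.ball x₀ R \ S₂ ∧ ‖z.1 - z.2‖ ≤ ρ} := by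
    rintro y ⟨hy, hy2⟩
    have := (hc hy).2
    rw [mem_closedBall_iff_norm, norm_sub_rev] at this
    exact ⟨hx, ⟨(hc hy).1, hy2⟩, this⟩
  refine le_trans ?_ (measure_mono h1)
  refine le_trans ?_ le_measure_sdiff
  rw [volume_ball_euc hN _ (by positivity)]
  calc ENNReal.ofReal m = ENNReal.ofReal (2 * m - m) := by congr 1; ring
    _ = ENNReal.ofReal (2 * m) - ENNReal.ofReal m := ENNReal.ofReal_sub _ hm
    _ ≤ _ := tsub_le_tsub (ENNReal.ofReal_le_ofReal hm2) hS₂m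

/-- Decay of the superlevel sets at one scale. -/
theorem IsBoundedSupersolution.volume_level_le (hw : IsBoundedSupersolution ν η W w)
    (hψ : IsCutoff A x₀ R ψ) (hν : IsJumpMeasure σ Λ ν) (hΛ : 0 < Λ) (hN : 1 ≤ N) (h₀ : 0 < σ)
    (h₂ : σ < 2) (hη : 0 ≤ η) {k ρ m : ℝ} (hk : 0 < k) (hρ : 0 < ρ) (hρR : ρ ≤ R) (hm : 0 ≤ m)
    (hm2 : 2 * m ≤ volume.real (Metric.ball (0 : Euc N) 1) * (ρ / 2) ^ N)
    (hlev : volume.real (Metric.ball x₀ R ∩ {x | k / 2 < w x}) ≤ m) :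
    m * volume.real (Metric.ball x₀ R ∩ {x | 2 * k < w x}) * k ≤
      2 * Λ * (3 * A * (Λ * (levyMoment N σ).toReal) + 2 * η) *
        (∫ x in Metric.ball x₀ (2 * R), w x) * ρ ^ ((N : ℝ) + σ) := by
  have hwm := hw.measurable
  have hψm := hψ.measurable
  have hms : ∀ t : ℝ, MeasurableSet (Metric.ball x₀ R ∩ {x | t < w x}) := fun t =>
    measurableSet_ball.inter (measurableSet_lt measurable_const hwm)
  have hfin : ∀ t : ℝ, volume (Metric.ball x₀ R ∩ {x | t < w x}) ≠ ⊤ := fun t =>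
    measure_ne_top_of_subset Set.inter_subset_left measure_ball_lt_top.ne
  obtain ⟨hFi, hF⟩ := hw.integral_level_le hψ hν hΛ hN h₀ h₂ hη hk
  set F : Euc N × Euc N → ℝ := fun z => max (w z.1 - k) 0 * (max (k - w z.2) 0 * ψ z.2 ^ 2) +
      max (w z.2 - k) 0 * (max (k - w z.1) 0 * ψ z.1 ^ 2) with hFdef
  have hF0 : ∀ z, 0 ≤ F z := fun z => by rw [hFdef]; positivity
  have hFm : Measurable F := by rw [hFdef]; fun_prop
  set S₁ := Metric.ball x₀ R ∩ {x | 2 * k < w x}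
  set S₂ := Metric.ball x₀ R ∩ {x | k / 2 < w x}
  set Z := {z : Euc N × Euc N | z.1 ∈ S₁ ∧ z.2 ∈ Metric.ball x₀ R \ S₂ ∧ ‖z.1 - z.2‖ ≤ ρ}
  have hZ : MeasurableSet Z :=
    (measurable_fst (hms _)).inter ((measurable_snd (measurableSet_ball.diff (hms _))).inter
      (measurableSet_le (f := fun z : Euc N × Euc N => ‖z.1 - z.2‖) (by fun_prop)
        measurable_const))
  have hlow := hν.setLIntegral_le hΛ hN h₀ hFm hF0 hFi hZ (d := ρ) fun z hz => hz.2.2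
  have hS₂m : volume S₂ ≤ ENNReal.ofReal m := by
    rw [← ofReal_measureReal (hfin _)]; exact ENNReal.ofReal_le_ofReal hlev
  have hvol := volume_prod_ge hN (hms (2 * k)) (hms (k / 2)) Set.inter_subset_left hρ hρR hm hm2 hS₂m
  -- On `Z` the excess at the first point is at least k, the deficit at the second at least k/2, and
  -- ψ = 1 there.
  have hZF : ENNReal.ofReal (k ^ 2 / 2) * volume Z ≤ ∫⁻ z in Z, ENNReal.ofReal (F z) := by
    rw [← setLIntegral_const]
    refine setLIntegral_mono_ae' hZ (Eventually.of_forall fun z hz => ?_)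
    refine ENNReal.ofReal_le_ofReal ?_
    obtain ⟨⟨hz1, hz2⟩, ⟨hz3, hz4⟩, -⟩ := hz
    have hz2' : 2 * k < w z.1 := hz2
    have hz4' : w z.2 ≤ k / 2 := by
      by_contra h
      exact hz4 ⟨hz3, not_le.1 h⟩
    have e1 : k ≤ max (w z.1 - k) 0 := le_max_of_le_left (by linarith)
    have e2 : k / 2 ≤ max (k - w z.2) 0 := le_max_of_le_left (by linarith)
    rw [hFdef]
    simp only
    rw [hψ.eq_one _ hz3]
    have e3 : 0 ≤ max (w z.2 - k) 0 * (max (k - w z.1) 0 * ψ z.1 ^ 2) := by positivity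
    nlinarith [mul_le_mul e1 e2 (by positivity) (le_max_right _ _)]
  have hρp : 0 < ρ ^ ((N : ℝ) + σ) := Real.rpow_pos_of_pos hρ _
  have hfinal : ENNReal.ofReal (1 / ρ ^ ((N : ℝ) + σ) * (k ^ 2 / 2 * (m * volume.real S₁))) ≤
      ENNReal.ofReal (Λ * ∫ z, F z ∂ν) := by
    refine le_trans ?_ hlow
    rw [ENNReal.ofReal_mul (by positivity), ENNReal.ofReal_mul (by positivity),
      ENNReal.ofReal_mul hm, ofReal_measureReal (hfin _)]
    gcongr
    exact le_trans (by gcongr) hZF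
  rw [ENNReal.ofReal_le_ofReal_iff (mul_nonneg hΛ.le (integral_nonneg hF0)), one_div,
    inv_mul_le_iff₀ hρp] at hfinal
  have h1 := hfinal.trans (mul_le_mul_of_nonneg_left (mul_le_mul_of_nonneg_left hF hΛ.le) hρp.le)
  refine le_of_mul_le_mul_left ?_ (half_pos hk)
  linarith

end Levels

/-! ### From the recursion to weak type, and from weak type to L^p. -/

section Reals

/-- Power decay of a bounded function, vanishing at infinity, which satisfies a nonlinear
recursion between the levels `k / 2` and `2 * k`. -/
theorem le_rpow_of_level_recursion {a : ℝ → ℝ} {V M W D b θ P : ℝ}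
    (ha0 : ∀ k, 0 ≤ a k) (haV : ∀ k, a k ≤ V) (haW : ∀ k, W ≤ k → a k = 0)
    (haM : ∀ k, 0 < k → a k ≤ M / k) (hM : 0 < M) (hV : 0 ≤ V) (hb : 0 < b) (hD : 0 ≤ D)
    (hθ₀ : 0 < θ) (hθ₁ : θ < 1)
    (hrec : ∀ k, 0 < k → a (k / 2) ≤ b → a (2 * k) ≤ D * (M / k) * a (k / 2) ^ θ)
    (hP : 4 / b * V ^ (1 - θ) ≤ P) (hP' : 2 ^ ((1 + θ) / (1 - θ)) * D ≤ P) {k : ℝ} (hk : 0 < k) :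
    a k ≤ (P * M / k) ^ (1 / (1 - θ)) := by
  have h1θ : 0 < 1 - θ := by linarith
  set s := 1 / (1 - θ) with hs
  have hs0 : 0 < s := by positivity
  have hsθ : s * (1 - θ) = 1 := by rw [hs]; field_simp
  have hP0 : 0 ≤ P := le_trans (by positivity) hP
  set U : Set ℝ := {y | ∃ k : ℝ, 0 < k ∧ y = k ^ s * a k} with hU
  -- The vanishing of a beyond W only serves to make the supremum finite, so that it can be absorbed
  -- later; W does not enter the final bound.
  have hbdd : BddAbove U := by
    refine ⟨max W 0 ^ s * V, ?_⟩
    rintro y ⟨k, hk, rfl⟩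
    rcases le_total W k with h | h
    · rw [haW k h, mul_zero]; positivity
    · exact mul_le_mul (Real.rpow_le_rpow hk.le (le_max_of_le_left h) hs0.le) (haV k) (ha0 k)
        (by positivity)
  have hne : U.Nonempty := ⟨_, 1, one_pos, rfl⟩
  set S := sSup U with hS
  have hle : ∀ k, 0 < k → k ^ s * a k ≤ S := fun k hk => le_csSup hbdd ⟨k, hk, rfl⟩
  have hS0 : 0 ≤ S := le_trans (mul_nonneg (by positivity) (ha0 1)) (hle 1 one_pos)
  have hbound : ∀ k, 0 < k → (2 * k) ^ s * a (2 * k) ≤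
      max ((P * M) ^ s) (2 ^ ((1 + θ) / (1 - θ)) * D * M * S ^ θ) := by
    intro k hk
    -- Low levels are covered by a ≤ V. Above 2M/b, Chebyshev's bound gives a(k/2) ≤ b and the
    -- recursion applies.
    rcases le_or_gt k (2 * M / b) with h | h
    · refine le_max_of_le_left ?_
      have hV' : V = (V ^ (1 - θ)) ^ s := by
        rw [← Real.rpow_mul hV, mul_comm (1 - θ), hsθ, Real.rpow_one]
      calc (2 * k) ^ s * a (2 * k) ≤ (4 * M / b) ^ s * V := by
            gcongr
            · exact ha0 _
            · calc 2 * k ≤ 2 * (2 * M / b) := by linarith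
                _ = 4 * M / b := by ring
            · exact haV _
        _ = (4 / b * V ^ (1 - θ) * M) ^ s := by
            nth_rewrite 1 [hV']
            rw [← Real.mul_rpow (by positivity) (by positivity)]
            congr 1
            ring
        _ ≤ (P * M) ^ s := by gcongr
    · refine le_max_of_le_right ?_
      have h1 : a (k / 2) ≤ b := by
        refine (haM _ (half_pos hk)).trans ?_
        rw [div_lt_iff₀ hb] at h
        rw [div_le_iff₀ (half_pos hk)]
        linarith
      have h2 := hrec k hk h1
      have hk2 : 0 < (k / 2) ^ s := Real.rpow_pos_of_pos (half_pos hk) _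
      have h3 : a (k / 2) ≤ S / (k / 2) ^ s := by
        rw [le_div_iff₀ hk2, mul_comm]
        exact hle _ (half_pos hk)
      -- The exponent s = 1/(1-θ) is the one for which all powers of k cancel in the recursion.
      have hexp : s * θ = s - 1 := by linarith
      calc (2 * k) ^ s * a (2 * k)
          ≤ (2 * k) ^ s * (D * (M / k) * (S / (k / 2) ^ s) ^ θ) := by
            gcongr
            exact h2.trans (by gcongr; exact ha0 _)
        _ = 2 ^ ((1 + θ) / (1 - θ)) * D * M * S ^ θ := by
            rw [Real.div_rpow hS0 hk2.le, ← Real.rpow_mul (half_pos hk).le, hexp,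
              Real.div_rpow hk.le two_pos.le, Real.mul_rpow two_pos.le hk.le]
            have e1 : (2 : ℝ) ^ ((1 + θ) / (1 - θ)) = 2 ^ s * 2 ^ (s - 1) := by
              rw [← Real.rpow_add two_pos]
              congr 1
              rw [← hexp, hs]
              field_simp
            have e2 : k ^ s = k ^ (s - 1) * k := by
              rw [← Real.rpow_add_one hk.ne']; congr 1; ring
            have p1 : 0 < k ^ (s - 1) := Real.rpow_pos_of_pos hk _
            have p2 : (0 : ℝ) < 2 ^ (s - 1) := Real.rpow_pos_of_pos two_pos _
            rw [e1, e2]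
            field_simp
  have hSle : S ≤ max ((P * M) ^ s) (2 ^ ((1 + θ) / (1 - θ)) * D * M * S ^ θ) := by
    refine csSup_le hne ?_
    rintro y ⟨k, hk, rfl⟩
    have := hbound (k / 2) (half_pos hk)
    rwa [mul_div_cancel₀ k two_ne_zero] at this
  have hSP : S ≤ (P * M) ^ s := by
    rcases le_max_iff.1 hSle with h | h
    · exact h
    · rcases eq_or_lt_of_le hS0 with h0 | h0
      · rw [← h0]; positivity
      -- Since θ < 1, the factor S^θ is absorbed into the left-hand side.
      · have h1 : S ^ (1 - θ) ≤ P * M := by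
          rw [Real.rpow_sub h0, Real.rpow_one, div_le_iff₀ (Real.rpow_pos_of_pos h0 _)]
          exact h.trans (by gcongr)
        calc S = (S ^ (1 - θ)) ^ s := by
              rw [← Real.rpow_mul hS0, mul_comm (1 - θ), hsθ, Real.rpow_one]
          _ ≤ (P * M) ^ s := by gcongr
  rw [Real.div_rpow (by positivity) hk.le, le_div_iff₀ (Real.rpow_pos_of_pos hk _), mul_comm]
  exact (hle k hk).trans hSP

/-- A function in weak `L^s` on a set of finite measure is in `L^p` for `p < s`. -/
theorem eLpNorm_le_of_weak {α : Type*} [MeasurableSpace α] {μ : Measure α} [IsFiniteMeasure μ]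
    {w : α → ℝ} (hw : Measurable w) (hw0 : ∀ x, 0 ≤ w x) {p s T V : ℝ} (hp : 1 ≤ p) (hps : p < s)
    (hT : 0 < T) (hV : μ.real Set.univ ≤ V)
    (hweak : ∀ k, 0 < k → μ.real {x | k < w x} ≤ (T / k) ^ s) :
    eLpNorm w (ENNReal.ofReal p) μ ≤ ENNReal.ofReal (T * (1 + (V + p / (s - p)))) := by
  have hp0 : 0 < p := by linarith
  have hsp : 0 < s - p := by linarith
  have hV0 : 0 ≤ V := measureReal_nonneg.trans hV
  have hmeas : ∀ k, 0 < k → μ {x | k < w x} ≤ ENNReal.ofReal ((T / k) ^ s) := fun k hk => by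
    rw [← ofReal_measureReal (measure_ne_top _ _)]
    exact ENNReal.ofReal_le_ofReal (hweak k hk)
  have hmeasV : ∀ k, μ {x | k < w x} ≤ ENNReal.ofReal V := fun k => by
    rw [← ofReal_measureReal (measure_ne_top _ _)]
    exact ENNReal.ofReal_le_ofReal ((measureReal_mono (Set.subset_univ _)).trans hV)
  -- Layer cake formula split at T: below it the total mass is used, above it the weak bound,
  -- integrable at infinity because p < s.
  have hlow : ∫⁻ t in Set.Ioc 0 T, μ {x | t < w x} * ENNReal.ofReal (t ^ (p - 1)) ≤
      ENNReal.ofReal (V * (T ^ p / p)) := by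
    have hi : IntegrableOn (fun t : ℝ => t ^ (p - 1)) (Set.Ioc 0 T) := by
      rw [← intervalIntegrable_iff_integrableOn_Ioc_of_le hT.le]
      exact intervalIntegral.intervalIntegrable_rpow' (by linarith)
    have he : ∫ t in Set.Ioc 0 T, t ^ (p - 1) = T ^ p / p := by
      rw [← intervalIntegral.integral_of_le hT.le, integral_rpow (Or.inl (by linarith))]
      simp [hp0.ne']
    calc _ ≤ ∫⁻ t in Set.Ioc 0 T, ENNReal.ofReal V * ENNReal.ofReal (t ^ (p - 1)) :=
          lintegral_mono fun t => by gcongr; exact hmeasV t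
      _ = _ := by
          rw [lintegral_const_mul _ (by fun_prop), ENNReal.ofReal_mul hV0, ← he,
            ofReal_integral_eq_lintegral_ofReal hi]
          rw [EventuallyLE, ae_restrict_iff' measurableSet_Ioc]
          exact Eventually.of_forall fun t ht => Real.rpow_nonneg ht.1.le _
  have hhigh : ∫⁻ t in Set.Ioi T, μ {x | t < w x} * ENNReal.ofReal (t ^ (p - 1)) ≤
      ENNReal.ofReal (T ^ p / (s - p)) := by
    have hi : IntegrableOn (fun t : ℝ => t ^ (p - 1 - s)) (Set.Ioi T) :=
      integrableOn_Ioi_rpow_of_lt (by linarith) hT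
    have he : ∫ t in Set.Ioi T, T ^ s * t ^ (p - 1 - s) = T ^ p / (s - p) := by
      rw [integral_const_mul, integral_Ioi_rpow_of_lt (by linarith) hT]
      have e1 : p - 1 - s + 1 = -(s - p) := by ring
      rw [e1, neg_div_neg_eq, mul_div_assoc', ← Real.rpow_add hT]
      congr 2; ring
    rw [← he, ofReal_integral_eq_lintegral_ofReal (hi.const_mul _)]
    · refine setLIntegral_mono_ae' measurableSet_Ioi (Eventually.of_forall fun t ht => ?_)
      have ht0 : 0 < t := hT.trans ht
      refine (mul_le_mul_left (hmeas t ht0) _).trans (le_of_eq ?_)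
      rw [← ENNReal.ofReal_mul (by positivity), Real.div_rpow hT.le ht0.le, div_mul_eq_mul_div,
        mul_div_assoc, ← Real.rpow_sub ht0]
    · rw [EventuallyLE, ae_restrict_iff' measurableSet_Ioi]
      refine Eventually.of_forall fun t ht => ?_
      have ht0 : 0 < t := hT.trans ht
      simp only [Pi.zero_apply]
      positivity
  have htot : ∫⁻ x, ENNReal.ofReal (w x ^ p) ∂μ ≤
      ENNReal.ofReal (T ^ p * (V + p / (s - p))) := by
    rw [lintegral_rpow_eq_lintegral_meas_lt_mul μ (Eventually.of_forall hw0) hw.aemeasurable hp0,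
      ← Set.Ioc_union_Ioi_eq_Ioi hT.le,
      lintegral_union measurableSet_Ioi (Set.Ioc_disjoint_Ioi le_rfl)]
    refine (mul_le_mul_right (add_le_add hlow hhigh) _).trans (le_of_eq ?_)
    rw [← ENNReal.ofReal_add (by positivity) (by positivity), ← ENNReal.ofReal_mul hp0.le]
    congr 1
    field_simp
  rw [eLpNorm_eq_lintegral_rpow_enorm_toReal (by simpa using hp0) ENNReal.ofReal_ne_top,
    ENNReal.toReal_ofReal hp0.le]
  have hX : 0 ≤ V + p / (s - p) := by positivity
  calc (∫⁻ x, ‖w x‖ₑ ^ p ∂μ) ^ (1 / p)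
      = (∫⁻ x, ENNReal.ofReal (w x ^ p) ∂μ) ^ (1 / p) := by
        congr 1
        refine lintegral_congr fun x => ?_
        rw [Real.enorm_of_nonneg (hw0 x), ENNReal.ofReal_rpow_of_nonneg (hw0 x) hp0.le]
    _ ≤ (ENNReal.ofReal (T ^ p * (V + p / (s - p)))) ^ (1 / p) := by gcongr
    _ = ENNReal.ofReal (T * (V + p / (s - p)) ^ (1 / p)) := by
        rw [ENNReal.ofReal_rpow_of_nonneg (by positivity) (by positivity),
          Real.mul_rpow (by positivity) hX, ← Real.rpow_mul hT.le, mul_one_div_cancel hp0.ne',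
          Real.rpow_one]
    _ ≤ _ := by
        -- The root X^{1/p} is replaced by 1 + X, valid as p ≥ 1, to keep the bound linear in the
        -- volume.
        refine ENNReal.ofReal_le_ofReal (mul_le_mul_of_nonneg_left ?_ hT.le)
        rcases le_total (V + p / (s - p)) 1 with h | h
        · exact (Real.rpow_le_one hX h (by positivity)).trans (by linarith)
        · calc _ ≤ (V + p / (s - p)) ^ (1 : ℝ) :=
                Real.rpow_le_rpow_of_exponent_le h (by rw [div_le_one hp0]; exact hp)
            _ ≤ _ := by rw [Real.rpow_one]; linarith

end Reals

/-! ### The weak Harnack inequality for radii at least one. -/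

section WeakHarnack

variable {N : ℕ} {σ Λ : ℝ}

theorem volume_real_ball_euc (hN : 1 ≤ N) (x : Euc N) {r : ℝ} (hr : 0 ≤ r) :
    volume.real (Metric.ball x r) = volume.real (Metric.ball (0 : Euc N) 1) * r ^ N := by
  rw [Measure.real, volume_ball_euc hN x hr, ENNReal.toReal_ofReal (by positivity)]

section

variable {ν : Measure (Euc N × Euc N)} {A R η W : ℝ} {x₀ : Euc N} {w ψ : Euc N → ℝ}

/-- The nonlinear recursion satisfied by the measures of the superlevel sets. -/
theorem IsBoundedSupersolution.level_recursion (hw : IsBoundedSupersolution ν η W w)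
    (hψ : IsCutoff A x₀ R ψ) (hν : IsJumpMeasure σ Λ ν) (hΛ : 0 < Λ) (hN : 1 ≤ N) (h₀ : 0 < σ)
    (h₂ : σ < 2) (hη : 0 ≤ η) (hR : 1 ≤ R) {θ : ℝ} (hθ₀ : 0 < θ) (hθ : N * θ ≤ σ) {k c₁ : ℝ} (hk : 0 < k)
    (hc₁ : c₁ = volume.real (Metric.ball (0 : Euc N) 1) / (2 * 2 ^ N))
    (hlev : volume.real (Metric.ball x₀ R ∩ {x | k / 2 < w x}) ≤ c₁ * R ^ N) :
    volume.real (Metric.ball x₀ R ∩ {x | 2 * k < w x}) ≤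
      2 * Λ * (3 * A * (Λ * (levyMoment N σ).toReal) + 2 * η) / c₁ * R ^ σ / c₁ ^ θ *
        ((∫ x in Metric.ball x₀ (2 * R), w x) / k) *
        volume.real (Metric.ball x₀ R ∩ {x | k / 2 < w x}) ^ θ := by
  have hA := hψ.const_nonneg
  have hω : 0 < volume.real (Metric.ball (0 : Euc N) 1) :=
    ENNReal.toReal_pos (Metric.measure_ball_pos _ _ one_pos).ne' measure_ball_lt_top.ne
  have hc₁0 : 0 < c₁ := by rw [hc₁]; positivity
  have hR0 : 0 < R := by linarith
  have hM : 0 ≤ ∫ x in Metric.ball x₀ (2 * R), w x := integral_nonneg hw.nonneg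
  have hmono : volume.real (Metric.ball x₀ R ∩ {x | 2 * k < w x}) ≤
      volume.real (Metric.ball x₀ R ∩ {x | k / 2 < w x}) := by
    refine measureReal_mono (Set.inter_subset_inter_right _ fun x hx => ?_)
      (measure_ne_top_of_subset Set.inter_subset_left measure_ball_lt_top.ne)
    have hx' : 2 * k < w x := hx
    show k / 2 < w x
    linarith
  set m := volume.real (Metric.ball x₀ R ∩ {x | k / 2 < w x}) with hmdef
  set M := ∫ x in Metric.ball x₀ (2 * R), w x with hMdef
  set C₁ := 3 * A * (Λ * (levyMoment N σ).toReal) + 2 * η with hC₁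
  have hC₁0 : 0 ≤ C₁ := by positivity
  have hm0 : 0 ≤ m := measureReal_nonneg
  -- For m = 0 there is no admissible radius ρ > 0; monotonicity of the superlevel sets suffices.
  rcases eq_or_lt_of_le hm0 with h0 | h0
  · exact (hmono.trans h0.symm.le).trans (by positivity)
  -- This is the smallest radius at which a ball of radius ρ/2 has volume 2m, so that removing a set
  -- of measure m leaves at least m. The hypothesis `hlev` says precisely that ρ ≤ R.
  set ρ := (m / c₁) ^ ((N : ℝ)⁻¹) with hρ
  have hN0 : N ≠ 0 := by omega
  have hρ0 : 0 < ρ := Real.rpow_pos_of_pos (div_pos h0 hc₁0) _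
  have hρN : ρ ^ N = m / c₁ := Real.rpow_inv_natCast_pow (by positivity) hN0
  have hρR : ρ ≤ R := by
    rw [← pow_le_pow_iff_left₀ hρ0.le hR0.le hN0, hρN, div_le_iff₀ hc₁0, mul_comm]
    exact hlev
  have hlevel := hw.volume_level_le hψ hν hΛ hN h₀ h₂ hη hk hρ0 hρR hm0
    (le_of_eq (by rw [div_pow, hρN, hc₁]; field_simp)) le_rfl
  -- The natural exponent is σ/N; the room θ ≤ σ/N is paid for by ρ^{σ-Nθ} ≤ R^σ and is needed when
  -- σ ≥ N.
  have hρσ : ρ ^ σ ≤ R ^ σ * (m / c₁) ^ θ := by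
    have e1 : ρ ^ σ = ρ ^ (σ - N * θ) * ρ ^ (N * θ) := by
      rw [← Real.rpow_add hρ0]; congr 1; ring
    have e2 : ρ ^ (N * θ) = (m / c₁) ^ θ := by
      rw [Real.rpow_mul hρ0.le, Real.rpow_natCast, hρN]
    have e3 : ρ ^ (σ - N * θ) ≤ R ^ (σ - N * θ) :=
      Real.rpow_le_rpow hρ0.le hρR (by linarith)
    rw [e1, e2]
    have e4 : R ^ (σ - N * θ) ≤ R ^ σ := Real.rpow_le_rpow_of_exponent_le hR (by
      have : 0 ≤ N * θ := by positivity
      linarith)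
    gcongr
    exact e3.trans e4
  rw [Real.rpow_add hρ0, Real.rpow_natCast, hρN] at hlevel
  set a₂ := volume.real (Metric.ball x₀ R ∩ {x | 2 * k < w x})
  have h1 : a₂ * k ≤ 2 * Λ * C₁ * M / c₁ * (R ^ σ * (m / c₁) ^ θ) := by
    have h2 : a₂ * k ≤ 2 * Λ * C₁ * M / c₁ * ρ ^ σ := by
      refine le_of_mul_le_mul_left ?_ h0
      calc m * (a₂ * k) = m * a₂ * k := by ring
        _ ≤ _ := hlevel
        _ = _ := by ring
    exact h2.trans (by gcongr)
  rw [← le_div_iff₀ hk, Real.div_rpow hm0 hc₁0.le] at h1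
  refine h1.trans (le_of_eq ?_)
  ring

/-- The weak-type estimate for supersolutions on balls of radius at least one. -/
theorem IsBoundedSupersolution.volume_superlevel_le (hw : IsBoundedSupersolution ν η W w)
    (hψ : IsCutoff A x₀ R ψ) (hν : IsJumpMeasure σ Λ ν) (hΛ : 0 < Λ) (hN : 1 ≤ N) (h₀ : 0 < σ)
    (h₂ : σ < 2) (hη : 0 ≤ η) (hR : 1 ≤ R) {θ : ℝ} (hθ₀ : 0 < θ) (hθ₁ : θ < 1) (hθ : N * θ ≤ σ)
    {k c₁ ω D₀ : ℝ} (hk : 0 < k) (hω : ω = volume.real (Metric.ball (0 : Euc N) 1))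
    (hc₁ : c₁ = ω / (2 * 2 ^ N))
    (hD₀ : D₀ = 2 * Λ * (3 * A * (Λ * (levyMoment N σ).toReal) + 2 * η) / c₁ / c₁ ^ θ)
    (hM : 0 < ∫ x in Metric.ball x₀ (2 * R), w x) :
    volume.real (Metric.ball x₀ R ∩ {x | k < w x}) ≤
      ((4 * (1 + ω) / c₁ + 2 ^ ((1 + θ) / (1 - θ)) * D₀) * R ^ σ *
        (∫ x in Metric.ball x₀ (2 * R), w x) / k) ^ (1 / (1 - θ)) := by
  have hA := hψ.const_nonneg
  have hω0 : 0 < ω := by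
    rw [hω]
    exact ENNReal.toReal_pos (Metric.measure_ball_pos _ _ one_pos).ne' measure_ball_lt_top.ne
  have hc₁0 : 0 < c₁ := by rw [hc₁]; positivity
  have hR0 : 0 < R := by linarith
  have hwm := hw.measurable
  have hRN1 : 1 ≤ R ^ N := one_le_pow₀ hR
  have hRσ1 : 1 ≤ R ^ σ := Real.one_le_rpow hR h₀.le
  have hD₀0 : 0 ≤ D₀ := by rw [hD₀]; positivity
  have hq0 : (0 : ℝ) < 2 ^ ((1 + θ) / (1 - θ)) := Real.rpow_pos_of_pos two_pos _
  have hfin : ∀ k, volume (Metric.ball x₀ R ∩ {x | k < w x}) ≠ ⊤ := fun k =>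
    measure_ne_top_of_subset Set.inter_subset_left measure_ball_lt_top.ne
  refine le_rpow_of_level_recursion (a := fun k => volume.real (Metric.ball x₀ R ∩ {x | k < w x}))
    (V := ω * R ^ N) (W := W) (D := D₀ * R ^ σ) (b := c₁ * R ^ N) (θ := θ)
    (fun k => measureReal_nonneg) (fun k => ?_) (fun k hk => ?_) (fun k hk => ?_) hM
    (by positivity) (by positivity) (by positivity) hθ₀ hθ₁ (fun k hk hlev => ?_) ?_ ?_ hk
  · rw [hω, ← volume_real_ball_euc hN x₀ hR0.le]
    exact measureReal_mono Set.inter_subset_left measure_ball_lt_top.ne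
  · have : {x | k < w x} = ∅ :=
      Set.eq_empty_of_forall_notMem fun x (hx : k < w x) => hx.not_ge ((hw.le x).trans hk)
    simp [this]
  · rw [le_div_iff₀ hk, mul_comm]
    calc k * volume.real (Metric.ball x₀ R ∩ {x | k < w x})
        = ∫ x in Metric.ball x₀ R ∩ {x | k < w x}, k := by
          rw [setIntegral_const, smul_eq_mul, mul_comm]
      _ ≤ ∫ x in Metric.ball x₀ R ∩ {x | k < w x}, w x :=
          setIntegral_mono_on (integrableOn_const (hfin k))
            ((hw.integrableOn R).mono_set Set.inter_subset_left)
            (measurableSet_ball.inter (measurableSet_lt measurable_const hwm))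
            fun x hx => (show k < w x from hx.2).le
      _ ≤ ∫ x in Metric.ball x₀ (2 * R), w x :=
          setIntegral_mono_set (hw.integrableOn _) (Eventually.of_forall hw.nonneg)
            (Set.inter_subset_left.trans (Metric.ball_subset_ball (by linarith))).eventuallyLE
  · refine (hw.level_recursion hψ hν hΛ hN h₀ h₂ hη hR hθ₀ hθ hk (hc₁.trans (by rw [hω]))
      hlev).trans (le_of_eq ?_)
    rw [hD₀]
    ring
  · have h1 : (ω * R ^ N) ^ (1 - θ) ≤ (1 + ω) * R ^ N := by
      have hx0 : 0 ≤ ω * R ^ N := by positivity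
      rcases le_total (ω * R ^ N) 1 with h | h
      · exact (Real.rpow_le_one hx0 h (by linarith)).trans (by nlinarith)
      · calc _ ≤ (ω * R ^ N) ^ (1 : ℝ) := Real.rpow_le_rpow_of_exponent_le h (by linarith)
          _ ≤ _ := by rw [Real.rpow_one]; nlinarith
    calc 4 / (c₁ * R ^ N) * (ω * R ^ N) ^ (1 - θ) ≤ 4 / (c₁ * R ^ N) * ((1 + ω) * R ^ N) := by
          gcongr
      _ = 4 * (1 + ω) / c₁ * 1 := by field_simp
      _ ≤ (4 * (1 + ω) / c₁ + 2 ^ ((1 + θ) / (1 - θ)) * D₀) * R ^ σ := by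
          gcongr
          exact le_add_of_nonneg_right (by positivity)
  · calc 2 ^ ((1 + θ) / (1 - θ)) * (D₀ * R ^ σ) = 2 ^ ((1 + θ) / (1 - θ)) * D₀ * R ^ σ := by ring
      _ ≤ (4 * (1 + ω) / c₁ + 2 ^ ((1 + θ) / (1 - θ)) * D₀) * R ^ σ := by
          gcongr
          exact le_add_of_nonneg_left (by positivity)

end

/-- The weak Harnack inequality on balls of radius at least one. -/
theorem exists_weak_harnack (hN : 1 ≤ N) (h₀ : 0 < σ) (h₂ : σ < 2) (hΛ : 0 < Λ) {η : ℝ}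
    (hη : 0 ≤ η) {p θ : ℝ} (hp : 1 ≤ p) (hθ₀ : 0 < θ) (hθ₁ : θ < 1) (hθ : N * θ ≤ σ)
    (hpθ : p < 1 / (1 - θ)) :
    ∃ C : ℝ, 0 < C ∧ ∀ (ν : Measure (Euc N × Euc N)) (W : ℝ) (w : Euc N → ℝ) (x₀ : Euc N) (R : ℝ),
      IsJumpMeasure σ Λ ν → IsBoundedSupersolution ν η W w → 1 ≤ R →
      ENNReal.ofReal (C * R ^ (-(2 * ((N : ℝ) + σ)))) *
          eLpNorm w (ENNReal.ofReal p) (volume.restrict (Metric.ball x₀ R)) ≤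
        essInf (fun x => ENNReal.ofReal (w x)) (volume.restrict (Metric.ball x₀ R)) := by
  obtain ⟨A, hAcut⟩ := exists_isCutoff N
  have hA : 0 ≤ A := by
    obtain ⟨ψ, hψ⟩ := hAcut 0 1 le_rfl
    exact hψ.const_nonneg
  set ω := volume.real (Metric.ball (0 : Euc N) 1) with hωdef
  have hω : 0 < ω :=
    ENNReal.toReal_pos (Metric.measure_ball_pos _ _ one_pos).ne' measure_ball_lt_top.ne
  have hvol : ∀ (x : Euc N) (r : ℝ), 0 ≤ r → volume.real (Metric.ball x r) = ω * r ^ N :=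
    fun x r hr => volume_real_ball_euc hN x hr
  set T := (levyMoment N σ).toReal with hT
  have hT0 : 0 ≤ T := ENNReal.toReal_nonneg
  set c₁ := ω / (2 * 2 ^ N) with hc₁
  have hc₁0 : 0 < c₁ := by positivity
  set C₁ := 3 * A * (Λ * T) + 2 * η with hC₁
  have hC₁0 : 0 ≤ C₁ := by positivity
  set C₂ := Λ * (A * (Λ * T) + 2 * η) with hC₂
  have hC₂0 : 0 ≤ C₂ := by positivity
  set D₀ := 2 * Λ * C₁ / c₁ / c₁ ^ θ with hD₀
  have hD₀0 : 0 ≤ D₀ := by positivity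
  set q := (2 : ℝ) ^ ((1 + θ) / (1 - θ)) with hq
  have hq0 : 0 < q := Real.rpow_pos_of_pos two_pos _
  set P₀ := 4 * (1 + ω) / c₁ + q * D₀ with hP₀
  have hP₀0 : 0 < P₀ := by positivity
  set Y₀ := 2 ^ N * ω + 4 ^ ((N : ℝ) + σ) * C₂ with hY₀
  have hY₀0 : 0 < Y₀ := by positivity
  set s := 1 / (1 - θ) with hs
  have hsp : 0 < s - p := by linarith
  set E₀ := 1 + (ω + p / (s - p)) with hE₀
  have hE₀0 : 0 < E₀ := by positivity
  refine ⟨1 / (2 * Y₀ * P₀ * E₀), by positivity, fun ν W w x₀ R hν hw hR => ?_⟩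
  obtain ⟨ψ, hψ⟩ := hAcut x₀ R hR
  have hR0 : 0 < R := by linarith
  have hwm := hw.measurable
  have hRN1 : 1 ≤ R ^ N := one_le_pow₀ hR
  have hRσ1 : 1 ≤ R ^ σ := Real.one_le_rpow hR h₀.le
  set M := ∫ x in Metric.ball x₀ (2 * R), w x with hM
  have hM0 : 0 ≤ M := integral_nonneg hw.nonneg
  have hsub : Metric.ball x₀ R ⊆ Metric.ball x₀ (2 * R) := Metric.ball_subset_ball (by linarith)
  have hMle : ∫ x in Metric.ball x₀ R, w x ≤ M :=
    setIntegral_mono_set (hw.integrableOn _) (Eventually.of_forall hw.nonneg) hsub.eventuallyLE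
  -- If M = 0, then w vanishes almost everywhere on the ball; the weak-type argument needs M > 0.
  rcases eq_or_lt_of_le hM0 with hM' | hM'
  · have h1 : w =ᵐ[volume.restrict (Metric.ball x₀ R)] 0 := by
      rw [← integral_eq_zero_iff_of_nonneg hw.nonneg (hw.integrableOn _)]
      exact le_antisymm (hMle.trans hM'.symm.le) (integral_nonneg hw.nonneg)
    rw [eLpNorm_congr_ae h1, eLpNorm_zero, mul_zero]
    exact zero_le
  set Y := volume.real (Metric.ball x₀ (2 * R)) + (4 * R) ^ ((N : ℝ) + σ) * C₂ with hY
  have hRs : R ^ ((N : ℝ) + σ) = R ^ N * R ^ σ := by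
    rw [Real.rpow_add hR0, Real.rpow_natCast]
  have hYle : Y ≤ Y₀ * R ^ ((N : ℝ) + σ) := by
    rw [hY, hvol _ _ (by positivity), Real.mul_rpow (by norm_num) hR0.le, hY₀, hRs, mul_pow]
    have : ω * (2 ^ N * R ^ N) * 1 ≤ ω * (2 ^ N * R ^ N) * R ^ σ := by gcongr
    linarith
  have hY0 : 0 < Y := by
    rw [hY, hvol _ _ (by positivity)]; positivity
  have hinf : ENNReal.ofReal (M / (2 * Y)) ≤
      essInf (fun x => ENNReal.ofReal (w x)) (volume.restrict (Metric.ball x₀ R)) := by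
    have hae := hw.ae_le_of_mul_lt_integral (t := M / (2 * Y)) hψ hν hΛ hN h₀ h₂ hη hR0
      (by positivity) (by
        change M / (2 * Y) * Y < M
        rw [show M / (2 * Y) * Y = M / 2 by field_simp]
        linarith)
    exact le_essInf_of_ae_le _ (hae.mono fun x hx => ENNReal.ofReal_le_ofReal hx)
  have : IsFiniteMeasure (volume.restrict (Metric.ball x₀ R)) :=
    ⟨by rw [Measure.restrict_apply_univ]; exact measure_ball_lt_top⟩
  have hPM : 0 < P₀ * R ^ σ * M := by positivity
  have hweak : ∀ k, 0 < k → (volume.restrict (Metric.ball x₀ R)).real {x | k < w x} ≤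
      (P₀ * R ^ σ * M / k) ^ s := by
    intro k hk
    rw [measureReal_restrict_apply (measurableSet_lt measurable_const hwm), Set.inter_comm]
    exact hw.volume_superlevel_le hψ hν hΛ hN h₀ h₂ hη hR hθ₀ hθ₁ hθ hk hωdef hc₁ hD₀ hM'
  have hLp := eLpNorm_le_of_weak (μ := volume.restrict (Metric.ball x₀ R)) hwm hw.nonneg hp hpθ hPM
    (V := ω * R ^ N) (by rw [measureReal_restrict_apply_univ, hvol _ _ hR0.le]) hweak
  refine le_trans ?_ hinf
  refine (mul_le_mul_right hLp _).trans ?_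
  rw [← ENNReal.ofReal_mul (by positivity)]
  refine ENNReal.ofReal_le_ofReal ?_
  have hE : 1 + (ω * R ^ N + p / (s - p)) ≤ E₀ * R ^ N := by
    have h1 : p / (s - p) * 1 ≤ p / (s - p) * R ^ N := by gcongr
    rw [hE₀]
    linarith
  -- The exponent collects R^{N+σ} from the lower bound, R^σ from the weak-type bound and R^N from
  -- the volume in the L^p bound.
  have hneg : R ^ (-(2 * ((N : ℝ) + σ))) = ((R ^ N * R ^ σ) * (R ^ N * R ^ σ))⁻¹ := by
    rw [← hRs, ← Real.rpow_add hR0, ← Real.rpow_neg hR0.le]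
    congr 1; ring
  have hRσ0 : 0 < R ^ σ := by linarith
  calc 1 / (2 * Y₀ * P₀ * E₀) * R ^ (-(2 * ((N : ℝ) + σ))) *
        (P₀ * R ^ σ * M * (1 + (ω * R ^ N + p / (s - p))))
      ≤ 1 / (2 * Y₀ * P₀ * E₀) * R ^ (-(2 * ((N : ℝ) + σ))) *
        (P₀ * R ^ σ * M * (E₀ * R ^ N)) := by gcongr
    _ = M / (2 * (Y₀ * R ^ ((N : ℝ) + σ))) := by
        rw [hneg, hRs]; field_simp
    _ ≤ M / (2 * Y) := by gcongr

end WeakHarnack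

/-! ### Reduction of the statement to measurable representatives and admissible exponents. -/

section Reduction

variable {N : ℕ} {σ Λ : ℝ} {J : Euc N → Euc N → ℝ} {f g w : Euc N → ℝ} {η : ℝ}

theorem ae_prod_eq_of_ae_eq (h : f =ᵐ[volume] g) :
    ∀ᵐ z : Euc N × Euc N, f z.1 = g z.1 ∧ f z.2 = g z.2 :=
  (Measure.quasiMeasurePreserving_fst.ae h).and (Measure.quasiMeasurePreserving_snd.ae h)

theorem gagliardoSq_congr_ae (h : f =ᵐ[volume] g) : gagliardoSq σ f = gagliardoSq σ g := by
  refine lintegral_congr_ae ?_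
  filter_upwards [ae_prod_eq_of_ae_eq h] with z hz
  rw [hz.1, hz.2]

theorem IsWeakSupersolution.congr_ae (hw : IsWeakSupersolution σ η J f) (h : f =ᵐ[volume] g) :
    IsWeakSupersolution σ η J g where
  locallyIntegrable := hw.locallyIntegrable.congr h
  finite_energy := gagliardoSq_congr_ae (σ := σ) h ▸ hw.finite_energy
  inequality := fun φ h1 h2 h3 => by
    have e1 : ∫ x, g x * φ x = ∫ x, f x * φ x :=
      integral_congr_ae (h.mono fun x hx => by simp only [hx])
    have e2 : energy J g φ = energy J f φ := by
      unfold energy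
      congr 1
      refine integral_congr_ae ?_
      filter_upwards [ae_prod_eq_of_ae_eq h] with z hz
      rw [hz.1, hz.2]
    rw [e1, e2]
    exact hw.inequality φ h1 h2 h3

theorem gagliardoSq_eq_lintegral (hf : Measurable f) :
    gagliardoSq σ f = ∫⁻ z, ENNReal.ofReal ((f z.1 - f z.2) ^ 2) ∂stableMeasure N σ := by
  rw [stableMeasure, lintegral_withDensity_eq_lintegral_mul _ measurable_stable_density
    (by fun_prop)]
  refine lintegral_congr fun z => ?_
  rw [Pi.mul_apply, ← ENNReal.ofReal_mul (by positivity), one_div_mul_eq_div]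

theorem memLp_sub_iff_lintegral {ν : Measure (Euc N × Euc N)} (hf : Measurable f) :
    MemLp (fun z : Euc N × Euc N => f z.1 - f z.2) 2 ν ↔
      ∫⁻ z, ENNReal.ofReal ((f z.1 - f z.2) ^ 2) ∂ν < ⊤ := by
  have hm : Measurable (fun z : Euc N × Euc N => f z.1 - f z.2) := by fun_prop
  rw [memLp_two_iff_integrable_sq hm.aestronglyMeasurable, Integrable,
    hasFiniteIntegral_iff_ofReal (Eventually.of_forall fun z => sq_nonneg _)]
  exact and_iff_right (hm.pow_const 2).aestronglyMeasurable

/-- The two-sided comparison makes finiteness of the energy independent of the jump measure, so it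
can be passed between the Gagliardo seminorm and J. -/
theorem IsJumpMeasure.memLp_sub_iff {ν : Measure (Euc N × Euc N)} (hν : IsJumpMeasure σ Λ ν)
    (hf : Measurable f) :
    MemLp (fun z : Euc N × Euc N => f z.1 - f z.2) 2 ν ↔ gagliardoSq σ f < ⊤ := by
  rw [memLp_sub_iff_lintegral hf, gagliardoSq_eq_lintegral hf]
  exact ⟨fun h => (hν.lintegral_ge _).trans_lt (ENNReal.mul_lt_top ENNReal.ofReal_lt_top h),
    fun h => (hν.lintegral_le _).trans_lt (ENNReal.mul_lt_top ENNReal.ofReal_lt_top h)⟩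

theorem energy_eq_integral_jumpMeasure (hN : 1 ≤ N) (hΛ : 0 < Λ)
    (hJ : IsStableLikeKernel σ Λ J) (f g : Euc N → ℝ) :
    energy J f g =
      (1 / 2) * ∫ z, (f z.1 - f z.2) * (g z.1 - g z.2) ∂jumpMeasure J := by
  rw [energy, jumpMeasure, integral_withDensity_eq_integral_toReal_smul₀
    hJ.aemeasurable.ennreal_ofReal (Eventually.of_forall fun z => ENNReal.ofReal_lt_top)]
  congr 1
  refine integral_congr_ae ?_
  filter_upwards [ae_fst_ne_snd hN] with z hz
  have : 0 ≤ J z.1 z.2 := le_trans (by positivity) (hJ.lower _ _ hz)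
  rw [ENNReal.toReal_ofReal this, smul_eq_mul, mul_comm]

theorem IsWeakSupersolution.isBoundedSupersolution (hN : 1 ≤ N) (hΛ : 0 < Λ)
    (hJ : IsStableLikeKernel σ Λ J) (hsup : IsWeakSupersolution σ η J w) (hw : Measurable w)
    (hw0 : ∀ x, 0 ≤ w x) {W : ℝ} (hwW : ∀ x, w x ≤ W) :
    IsBoundedSupersolution (jumpMeasure J) η W w where
  measurable := hw
  nonneg := hw0
  le := hwW
  memLp := ((jumpMeasure_isJumpMeasure hN hΛ hJ).memLp_sub_iff hw).2 hsup.finite_energy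
  test := fun v hv hv0 ⟨V, hvV⟩ hvc hve => by
    rw [← energy_eq_integral_jumpMeasure hN hΛ hJ]
    exact hsup.inequality_of_gagliardoSq_lt_top (W := W) hN hΛ hJ hw
      (fun x => by rw [abs_of_nonneg (hw0 x)]; exact hwW x) hv hv0 hvV hvc
      (((jumpMeasure_isJumpMeasure hN hΛ hJ).memLp_sub_iff hv).1 hve)

theorem exists_bounded_measurable_ae_eq {α : Type*} [MeasurableSpace α] {μ : Measure α}
    {w : α → ℝ} (hw : MemLp w ⊤ μ) (hw0 : ∀ᵐ x ∂μ, 0 ≤ w x) :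
    ∃ g : α → ℝ, Measurable g ∧ (∀ x, 0 ≤ g x) ∧ (∃ W, ∀ x, g x ≤ W) ∧ w =ᵐ[μ] g := by
  set W := (eLpNorm w ⊤ μ).toReal with hW
  have hwm := hw.aestronglyMeasurable.aemeasurable
  refine ⟨fun x => max 0 (min (hwm.mk w x) W), by fun_prop, fun x => le_max_left _ _,
    ⟨W, fun x => max_le ENNReal.toReal_nonneg (min_le_right _ _)⟩, ?_⟩
  have hle : ∀ᵐ x ∂μ, ‖w x‖ₑ ≤ eLpNorm w ⊤ μ := by
    rw [eLpNorm_exponent_top]; exact ae_le_eLpNormEssSup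
  filter_upwards [hwm.ae_eq_mk, hw0, hle] with x hx h0 hb
  have : w x ≤ W := by
    have := ENNReal.toReal_mono hw.eLpNorm_lt_top.ne hb
    rw [toReal_enorm, Real.norm_of_nonneg h0] at this
    exact this
  rw [← hx, min_eq_left this, max_eq_right h0]

/-- An exponent `p` below `N / (N - σ)₊` is below some `1 / (1 - θ)` with `θ ≤ σ / N`. -/
theorem exists_exponent (hN : 1 ≤ N) (h₀ : 0 < σ) {p : ℝ≥0∞} (hp₁ : 1 ≤ p)
    (hp : p < (N : ℝ≥0∞) / ENNReal.ofReal ((N : ℝ) - σ)) :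
    ∃ q θ : ℝ, p = ENNReal.ofReal q ∧ 1 ≤ q ∧ 0 < θ ∧ θ < 1 ∧ N * θ ≤ σ ∧ q < 1 / (1 - θ) := by
  have hN0 : (0 : ℝ) < N := by exact_mod_cast hN
  have hpt : p ≠ ⊤ := hp.ne_top
  have hpq : p = ENNReal.ofReal p.toReal := (ENNReal.ofReal_toReal hpt).symm
  have hq : 1 ≤ p.toReal := by
    have := ENNReal.toReal_mono hpt hp₁
    simpa using this
  rcases le_or_gt (N : ℝ) σ with h | h
  -- When N ≤ σ any θ < 1 is allowed; θ = 1 - 1/(2p) makes 1/(1-θ) = 2p > p.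
  · have hi : (2 * p.toReal)⁻¹ < 1 := inv_lt_one_of_one_lt₀ (by linarith)
    have hi0 : 0 < (2 * p.toReal)⁻¹ := by positivity
    refine ⟨p.toReal, 1 - (2 * p.toReal)⁻¹, hpq, hq, by linarith, by linarith, by nlinarith, ?_⟩
    rw [sub_sub_cancel, one_div, inv_inv]
    linarith
  · have hd : 0 < (N : ℝ) - σ := by linarith
    refine ⟨p.toReal, σ / N, hpq, hq, by positivity, by rwa [div_lt_one hN0],
      le_of_eq (mul_div_cancel₀ _ hN0.ne'), ?_⟩
    have e : (N : ℝ≥0∞) / ENNReal.ofReal ((N : ℝ) - σ) = ENNReal.ofReal (N / (N - σ)) := by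
      rw [ENNReal.ofReal_div_of_pos hd, ENNReal.ofReal_natCast]
    rw [e, hpq, ENNReal.ofReal_lt_ofReal_iff (by positivity)] at hp
    refine hp.trans_le (le_of_eq ?_)
    field_simp

end Reduction

end

theorem mainTheorem3 (N : ℕ) (hN : 1 ≤ N) (σ Λ : ℝ) (hσ₀ : 0 < σ) (hσ₂ : σ < 2) (hΛ : 0 < Λ)
    (p : ℝ≥0∞) (hp₁ : 1 ≤ p) (hp : p < (N : ℝ≥0∞) / ENNReal.ofReal ((N : ℝ) - σ))
    (η : ℝ) (hη : 0 ≤ η) :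
    ∃ K : ℝ → ℝ, (∀ R, 0 < R → 0 < K R) ∧
      (∃ C c R₀ : ℝ, 0 < C ∧ 0 < c ∧ 1 ≤ R₀ ∧
        ∀ R, R₀ ≤ R → K R = C * R ^ (-(c * R ^ (σ / 2)))) ∧
      ∀ J : EuclideanSpace ℝ (Fin N) → EuclideanSpace ℝ (Fin N) → ℝ,
        IsStableLikeKernel σ Λ J →
        ∀ w : EuclideanSpace ℝ (Fin N) → ℝ,
          MemLp w ⊤ volume → (∀ᵐ x ∂volume, 0 ≤ w x) → IsWeakSupersolution σ η J w →
          ∀ (x₀ : EuclideanSpace ℝ (Fin N)) (R : ℝ), 0 < R →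
            ENNReal.ofReal (K R) * eLpNorm w p (volume.restrict (Metric.ball x₀ R)) ≤
              essInf (fun x => ENNReal.ofReal (w x)) (volume.restrict (Metric.ball x₀ R)) := by
  obtain ⟨q, θ, rfl, hq, hθ₀, hθ₁, hθ, hqθ⟩ := exists_exponent hN hσ₀ hp₁ hp
  obtain ⟨C, hC, hharnack⟩ := exists_weak_harnack hN hσ₀ hσ₂ hΛ hη hq hθ₀ hθ₁ hθ hqθ
  have hmax : ∀ R : ℝ, 1 ≤ max R 1 := fun R => le_max_right _ _
  have hmax0 : ∀ R : ℝ, 0 < max R 1 := fun R => one_pos.trans_le (hmax R)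
  -- Here c = 2(N+σ) and R₀ = 1. The factor R^{σ/2} ≥ 1 in the exponent only weakens the polynomial
  -- constant, and the maximum with 1 makes K constant for R ≤ 1.
  refine ⟨fun R => C * max R 1 ^ (-(2 * ((N : ℝ) + σ) * max R 1 ^ (σ / 2))),
    fun R _ => mul_pos hC (Real.rpow_pos_of_pos (hmax0 R) _),
    ⟨C, 2 * ((N : ℝ) + σ), 1, hC, by positivity, le_rfl, fun R hR => by
      simp only [max_eq_left hR]⟩, ?_⟩
  intro J hJ w hw hw0 hsup x₀ R hR
  obtain ⟨g, hgm, hg0, ⟨W, hgW⟩, hwg⟩ := exists_bounded_measurable_ae_eq hw hw0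
  have hg := (hsup.congr_ae hwg).isBoundedSupersolution hN hΛ hJ hgm hg0 hgW
  have hmain := hharnack _ W g x₀ (max R 1) (jumpMeasure_isJumpMeasure hN hΛ hJ) hg (hmax R)
  have hres : volume.restrict (Metric.ball x₀ R) ≤ volume.restrict (Metric.ball x₀ (max R 1)) :=
    Measure.restrict_mono_set _ (Metric.ball_subset_ball (le_max_left _ _))
  have hwgR : w =ᵐ[volume.restrict (Metric.ball x₀ R)] g := ae_restrict_of_ae hwg
  have hinf : essInf (fun x => ENNReal.ofReal (w x)) (volume.restrict (Metric.ball x₀ R)) =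
      essInf (fun x => ENNReal.ofReal (g x)) (volume.restrict (Metric.ball x₀ R)) :=
    essInf_congr_ae (hwgR.mono fun x hx => by simp only [hx])
  rw [eLpNorm_congr_ae hwgR, hinf]
  -- Passing from radius max(R, 1) down to R can only raise the infimum and lower the L^p norm.
  refine le_trans ?_ (hmain.trans (essInf_antitone_measure (Measure.absolutelyContinuous_of_le hres)))
  refine mul_le_mul' (ENNReal.ofReal_le_ofReal ?_) (eLpNorm_mono_measure _ hres)
  refine mul_le_mul_of_nonneg_left (Real.rpow_le_rpow_of_exponent_le (hmax R) ?_) hC.le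
  have h1 : 1 ≤ max R 1 ^ (σ / 2) := Real.one_le_rpow (hmax R) (by positivity)
  have h2 : 0 < 2 * ((N : ℝ) + σ) := by positivity
  nlinarith
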